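/- Let $\alpha\ge 3$ be a countable ordinal which is the successor of a successor ordinal. Then the directed graph $H_\alpha$ on $\mathbb{Y}_\alpha$, defined below, has no countable $\boldsymbol\Sigma^0_\alpha$ colouring: there is no map $c\colon \mathbb{Y}_\alpha\to\mathbb N$ such that every $c^{-1}\{n\}$ is a $\boldsymbol\Sigma^0_\alpha$ subset of $\mathbb{Y}_\alpha$ (with the subspace topology) and $c(p)\neq c(q)$ for every edge $(p,q)$ of $H_\alpha$. This holds for every choice of the auxiliary data (1)–(3). **Auxiliary data.** (1) An identification of $\alpha$ with a well-ordering of a subset of $\mathbb N$, where $a_\beta\in\mathbb N$ denotes the element at position $\beta<\alpha$; and for every limit $\delta\le\alpha$ an increasing cofinal sequence $(\delta_k)_{k\in\mathbb N}$ in $\delta$. These determine the tree $T_\alpha\subset\mathbb N^{<\omega}$ and its rank function: the root has rank $\alpha$; if $\sigma\in T_\alpha$ has rank $\beta+1$ then every $\sigma\hat{\ }k$ is in $T_\alpha$ and has rank $\beta$; if $\sigma$ has limit rank $\delta$ then every $\sigma\hat{\ }k$ is in $T_\alpha$ and has rank $\delta_k$; the set $\mathscr L_\alpha$ of leaves consists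 of the nodes of rank $0$. (2) For every $\beta<\alpha$, an ordering $<^*_\beta$ of type $\omega$ of the nodes of rank $\beta$, such that $\sigma\hat{\ }k<^*_\beta\sigma\hat{\ }k'$ whenever $k<k'$ and both have rank $\beta$. (3) A sequence $(M_k)_{k\in\mathbb N}$ which is dense in $2^{\mathbb N}$. A number $k$ is a *code* of a finite binary string $\zeta$ if $\zeta\prec M_k$. **Labellings.** For $x\in 2^{\mathscr L_\alpha}$ define $T^x\colon T_\alpha\to\{0,1\}$ by $T^x(\sigma)=x(\sigma)$ for leaves, and, for non-leaves, $T^x(\sigma)=0$ iff $T^x(\sigma\hat{\ }k)=1$ for some $k$. Write $T^x(m,k)$ for $T^x(\langle m,k\rangle)$, etc. Let $n^x=\sup\{n: T^x(m)=0 \text{ for all } m<n\}\le\omega$, and for $m<n^x$ let $k^x(m)$ be the least $k$ with $T^x(m,k)=1$. **True stages.** Let $2^{<\mathscr L_\alpha}$ be the set of $\{0,1\}$-valued functions $t$ on finite $<^*_0$-initial segments of $\mathscr L_\alpha$, and $|t|$ the size of the domain; $s\prec t$ denotes proper extension. Partial labellings $T^t$ of $T_\alpha$ are defined by recursion on $|t|$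 and, for each $t$, on the rank of nodes; a subscript $\beta$ denotes restriction to nodes of rank $<\beta$. $T^{\langle\rangle}$ is empty. For nonempty $t$, $T^t(\sigma)=t(\sigma)$ on leaves. Let $0<\beta<\alpha$. If there are at most $a_\beta$ many $s\prec t$ with $T^s_\beta\subseteq T^t_\beta$, then $T^t$ is undefined on all nodes of rank $\beta$. Otherwise let $s$ be the longest such $s$, and let $\tau$ be the $<^*_\beta$-least node of rank $\beta$ such that either $T^s(\tau)$ is undefined, or $T^s(\tau)=1$ and $T^t(\tau\hat{\ }k)=1$ for some $k$. For $\sigma$ of rank $\beta$: if $\sigma<^*_\beta\tau$ then $T^t(\sigma)=T^s(\sigma)$; if $\sigma>^*_\beta\tau$ then $T^t(\sigma)$ is undefined; and $T^t(\tau)=0$ if $T^t(\tau\hat{\ }k)=1$ for some $k$, and $T^t(\tau)=1$ otherwise. (The label of the root is never used below.) **Coding locations.** Let $\alpha^*=\alpha-2$. For $s,t$ finite or infinite (i.e. in $2^{<\mathscr L_\alpha}\cup 2^{\mathscr L_\alpha}$) write $s\preceq_{\alpha^*}t$ if $T^s_{\alpha^*}\subseteq T^t_{\alpha^*}$, and $s\prec_{\alpha^*}t$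 if also $s\ne t$. For finite $t$ define $n^t$ by recursion: $n^{\langle\rangle}=0$; if $t\ne\langle\rangle$, let $s$ be the longest with $s\prec_{\alpha^*}t$; if there are $m<n^s$ and $a$ with $T^t(m,k^s(m),a)=1$ then $n^t$ is the least such $m$, and otherwise $n^t=n^s+1$. For $m<n^t$, $k^t(m)$ is the least $k$ such that there is no $a$ with $T^t(m,k,a)=1$. Write $s\sqsubseteq_m x$ if $s\preceq_{\alpha^*}x$, $m\le\min\{n^s,n^x\}$, and $k^s(\ell)=k^x(\ell)$ for all $\ell<m$. For $x\in 2^{\mathscr L_\alpha}$ and finite $m\le n^x$ let $c^x(m)=\min\{|s|: s\in 2^{<\mathscr L_\alpha},\ s\sqsubseteq_m x\}$. **The graph.** $\mathbb{Y}_\alpha$ is the set of all $(x,y)\in 2^{\mathscr L_\alpha}\times\mathscr P(\mathbb N)$ (with the product, i.e. Cantor, topology) such that for all $m<n^x$, $k^x(m)$ is a code of $y\restriction(c^x(m)+1)$, where $y$ is identified with its characteristic function. For $(x,y),(x',y')\in\mathbb{Y}_\alpha$, $((x,y),(x',y'))$ is an edge of $H_\alpha$ iff $x=x'$, $n^x<\omega$,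 $y\bigtriangleup y'=\{c^x(n^x)\}$ and $c^x(n^x)\notin y$. -/

import Mathlib

namespace BorelColouring

/-! ### The Borel hierarchy and countable colourings -/

/-- `IsSigma β A`: the set `A` is boldface `Σ⁰_β` (for a metrizable space `X`): the `Σ⁰_1` sets are
the open sets, and for `β > 1` the `Σ⁰_β` sets are the countable unions of sets which are `Π⁰_γ`
(that is, with `Σ⁰_γ` complement) for some `1 ≤ γ < β`. -/
inductive IsSigma {X : Type} [TopologicalSpace X] : Ordinal.{0} → Set X → Prop
  | of_isOpen (A : Set X) (hA : IsOpen A) : IsSigma 1 A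
  | iUnion (β : Ordinal.{0}) (hβ : 1 < β) (A : ℕ → Set X) (γ : ℕ → Ordinal.{0})
      (h1 : ∀ n, 1 ≤ γ n) (hlt : ∀ n, γ n < β) (hA : ∀ n, IsSigma (γ n) (A n)ᶜ) :
      IsSigma β (⋃ n, A n)

/-- The directed graph `G` on `X` has a countable `Σ⁰_β` colouring: a map `c : X → ℕ` whose colour
classes are all `Σ⁰_β`, such that the endpoints of every edge get different colours. -/
def HasCountableSigmaColouring {X : Type} [TopologicalSpace X] (β : Ordinal.{0})
    (G : Digraph X) : Prop :=
  ∃ c : X → ℕ, (∀ n, IsSigma β (c ⁻¹' {n})) ∧ ∀ p q, G.Adj p q → c p ≠ c q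

/-! ### The tree `T_α` -/

/-- The choices used to define the tree `T_α`: a copy of the well-ordering `α` with a subset of `ℕ`
as underlying set (`code β` is the element of this set at position `β < α`; this is the number
`a_β`, and `code β` is irrelevant for `β ≥ α`), and an increasing cofinal sequence `(δ_k)` in every limit `δ ≤ α`. Both
`δ_k = down δ k` for limits and `(β + 1)_k = β` are recorded in `down`. -/
structure Ladder (α : Ordinal.{0}) where
  code : Ordinal.{0} → ℕ
  code_injOn : Set.InjOn code (Set.Iio α)
  down : Ordinal.{0} → ℕ → Ordinal.{0}
  down_succ : ∀ β < α, ∀ k, down (β + 1) k = β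
  down_strictMono : ∀ δ ≤ α, Order.IsSuccLimit δ → StrictMono (down δ)
  down_limit_lt : ∀ δ ≤ α, Order.IsSuccLimit δ → ∀ k, down δ k < δ
  down_cofinal : ∀ δ ≤ α, Order.IsSuccLimit δ → ∀ β < δ, ∃ k, β ≤ down δ k

namespace Ladder

variable {α : Ordinal.{0}} (L : Ladder α)

/-- The rank of `τ` in the tree whose root has rank `β`. -/
def rankFrom (β : Ordinal.{0}) : List ℕ → Ordinal.{0}
  | [] => β
  | k :: τ => rankFrom (L.down β k) τ

/-- Membership of `τ` in the tree whose root has rank `β`; nodes of rank `0` are leaves. -/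
def InTreeFrom (β : Ordinal.{0}) : List ℕ → Prop
  | [] => True
  | k :: τ => β ≠ 0 ∧ InTreeFrom (L.down β k) τ

/-- The rank of a node of `T_α` (meaningful only for `σ` in `T_α`). -/
def rank (σ : List ℕ) : Ordinal.{0} := L.rankFrom α σ

/-- `σ ∈ T_α`. The child of `σ` with index `k` is `σ ++ [k]`. -/
def InTree (σ : List ℕ) : Prop := L.InTreeFrom α σ

/-- The leaves of `T_α`: the nodes of rank `0`. -/
abbrev Leaf : Type := {σ : List ℕ // L.InTree σ ∧ L.rank σ = 0}

/-- The nodes of `T_α` of rank `β`. -/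
def level (β : Ordinal.{0}) : Set (List ℕ) := {σ | L.InTree σ ∧ L.rank σ = β}

theorem down_lt {β : Ordinal.{0}} (hβ : β ≤ α) (h0 : β ≠ 0) (k : ℕ) : L.down β k < β := by
  rcases Ordinal.zero_or_succ_or_isSuccLimit β with h | ⟨γ, rfl⟩ | h
  · exact absurd h h0
  · have hγ : γ < α := lt_of_lt_of_le (Order.lt_succ γ) hβ
    have := L.down_succ γ hγ k
    rw [← Order.succ_eq_add_one] at this
    rw [this]
    exact Order.lt_succ γ
  · exact L.down_limit_lt β hβ h k

theorem rankFrom_append_lt (k : ℕ) : ∀ (σ : List ℕ) (β : Ordinal.{0}), β ≤ α →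
    L.InTreeFrom β σ → L.rankFrom β σ ≠ 0 → L.rankFrom β (σ ++ [k]) < L.rankFrom β σ
  | [], _, hβ, _, h0 => L.down_lt hβ h0 k
  | j :: σ, _, hβ, hσ, h0 =>
    rankFrom_append_lt k σ _ ((L.down_lt hβ hσ.1 j).le.trans hβ) hσ.2 h0

theorem rank_append_lt {σ : List ℕ} (hσ : L.InTree σ) (h0 : L.rank σ ≠ 0) (k : ℕ) :
    L.rank (σ ++ [k]) < L.rank σ :=
  L.rankFrom_append_lt k σ α le_rfl hσ h0

end Ladder

/-- A presentation of `α`: in addition to the choices for `T_α`, for every `β < α` an `ω`-ordering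
`<*_β` of the nodes of rank `β`, given by the position `pos σ ∈ ℕ` of each node in the ordering
(so `σ <*_β τ` iff `pos σ < pos τ`), such that siblings of the same rank are ordered by their
last entries. -/
structure Presentation (α : Ordinal.{0}) extends Ladder α where
  pos : List ℕ → ℕ
  pos_bijOn : ∀ β < α, Set.BijOn pos (toLadder.level β) Set.univ
  pos_sibling : ∀ β < α, ∀ (σ : List ℕ) (k k' : ℕ), k < k' →
    σ ++ [k] ∈ toLadder.level β → σ ++ [k'] ∈ toLadder.level β →
    pos (σ ++ [k]) < pos (σ ++ [k'])

/-- A partial `{0,1}`-labelling of `T_α`: `none` means undefined, `some true` is the label `1`,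
`some false` is the label `0`. Labellings are always undefined outside `T_α`. -/
abbrev Labelling : Type := List ℕ → Option Bool

namespace Presentation

open Classical

variable {α : Ordinal.{0}} (P : Presentation α)

/-- The point space `𝕏_α = 2^{leaves} × 𝒫(ℕ)`, a subset of `ℕ` being identified with its
characteristic function; both factors carry the product topology. -/
abbrev Point : Type := (P.Leaf → Bool) × (ℕ → Bool)

/-- The labelling `T^x` of `T_α` determined by a labelling `x` of the leaves: a non-leaf is labelled
`0` iff some child is labelled `1`. -/
noncomputable def fullLabel (x : P.Leaf → Bool) (σ : List ℕ) : Option Bool :=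
  if hσ : P.InTree σ then
    if h0 : P.rank σ = 0 then some (x ⟨σ, hσ, h0⟩)
    else if ∃ k, fullLabel x (σ ++ [k]) = some true then some false else some true
  else none
termination_by P.rank σ
decreasing_by exact P.rank_append_lt hσ h0 k

/-- `f_β ⊆ g_β`, where the subscript denotes the restriction to the nodes of rank `< β`. -/
def SubBelow (β : Ordinal.{0}) (f g : Labelling) : Prop :=
  ∀ σ, P.InTree σ → P.rank σ < β → ∀ b, f σ = some b → g σ = some b

/-! ### True stages

A finite initial segment of an element of `2^{leaves}` is a finite list `t` of bits, whose `i`-th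
entry is the label of the leaf with position `i` in `<*_0`. Its initial segments are the
`t.take i`. -/

/-- Given labellings `prev i` for `i < l` and a labelling `cur`, the set of `i < l` such that
`(prev i)_β ⊆ cur_β`. -/
noncomputable def preds (β : Ordinal.{0}) (l : ℕ) (prev : ℕ → Labelling) (cur : Labelling) :
    Finset ℕ :=
  (Finset.range l).filter fun i => P.SubBelow β (prev i) cur

/-- The node `τ` requires attention, when `s` is the labelling of the last relevant stage and `cur`
is the current labelling. -/
def Attention (s cur : Labelling) (τ : List ℕ) : Prop :=
  s τ = none ∨ (s τ = some true ∧ ∃ k, cur (τ ++ [k]) = some true)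

/-- The value of `T^t` at `σ`, given the labellings `prev i` of the initial segments of length
`i < |t|`, and the labelling `cur = T^t` on nodes of rank smaller than `rank σ`. In the last case,
`σ` lies before the `<*_β`-least node requiring attention. -/
noncomputable def labelStep (t : List Bool) (prev : ℕ → Labelling) (cur : Labelling)
    (σ : List ℕ) : Option Bool :=
  if ¬ P.InTree σ then none
  else if P.rank σ = 0 then t[P.pos σ]?
  else
    let S := P.preds (P.rank σ) t.length prev cur
    if S.card ≤ P.code (P.rank σ) then none
    else
      let s := prev (S.sup id)
      if ∃ τ ∈ P.level (P.rank σ), P.pos τ < P.pos σ ∧ Attention s cur τ then none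
      else if Attention s cur σ then
        if ∃ k, cur (σ ++ [k]) = some true then some false else some true
      else s σ

/-- The labelling of the string `t` by recursion on the rank of nodes, given the labellings of the
proper initial segments of `t`. -/
noncomputable def labelFrom (t : List Bool) (prev : ℕ → Labelling) (σ : List ℕ) : Option Bool :=
  P.labelStep t prev (fun ρ => if P.rank ρ < P.rank σ then labelFrom t prev ρ else none) σ
termination_by P.rank σ

/-- The partial labelling `T^t` of `T_α` for a finite string `t`. -/
noncomputable def approx (t : List Bool) : Labelling :=
  P.labelFrom t fun i => if i < t.length then approx (t.take i) else fun _ => none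
termination_by t.length
decreasing_by simp only [List.length_take]; omega

/-- `α* = α - 2` (for `α` a successor of a successor). -/
noncomputable def star (_P : Presentation α) : Ordinal.{0} := Ordinal.pred (Ordinal.pred α)

/-- The length of the longest `s ≺ t` (proper) such that `s ≺_{α*} t`; for nonempty `t`. -/
noncomputable def predLength (t : List Bool) : ℕ :=
  (P.preds P.star t.length (fun i => P.approx (t.take i)) (P.approx t)).sup id

theorem predLength_lt {t : List Bool} (ht : t ≠ []) : P.predLength t < t.length := by
  have h0 : 0 < t.length := List.length_pos_iff.2 ht
  refine (Finset.sup_lt_iff (by simpa using h0)).2 fun i hi => ?_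
  exact Finset.mem_range.1 (Finset.mem_filter.1 hi).1

/-! ### The numbers `n` and `k` -/

/-- `n^x = sup {n : T^x(m) = 0 for all m < n}`, possibly infinite. -/
noncomputable def nPoint (x : P.Leaf → Bool) : ℕ∞ :=
  ⨆ n ∈ {n : ℕ | ∀ m < n, P.fullLabel x [m] = some false}, (n : ℕ∞)

/-- `k^x(m)`, for `m < n^x`: the least `k` such that `T^x(m,k) = 1`. -/
noncomputable def kPoint (x : P.Leaf → Bool) (m : ℕ) : ℕ :=
  sInf {k | P.fullLabel x [m, k] = some true}

/-- `k^t(m)`, for `m < n^t`: the least `k` such that there is no `a` with `T^t(m,k,a) = 1`. -/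
noncomputable def kString (t : List Bool) (m : ℕ) : ℕ :=
  sInf {k | ¬ ∃ a, P.approx t [m, k, a] = some true}

/-- `n^t`: it is `0` for the empty string; otherwise, let `s` be longest with `s ≺_{α*} t`; then
`n^t` is the least `m < n^s` such that `T^t(m, k^s(m), a) = 1` for some `a`, if there is one, and
`n^s + 1` otherwise. -/
noncomputable def nString (t : List Bool) : ℕ :=
  if _ht : t = [] then 0
  else
    let s := t.take (P.predLength t)
    if ∃ m < nString s, ∃ a, P.approx t [m, P.kString s m, a] = some true then
      sInf {m | m < nString s ∧ ∃ a, P.approx t [m, P.kString s m, a] = some true}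
    else nString s + 1
termination_by t.length
decreasing_by
  all_goals
    have := P.predLength_lt _ht
    simp only [List.length_take]
    omega

/-! ### Coding locations and the graph `H_α` -/

/-- `s ⊑_m x` for a finite string `s` and an infinite `x`: `s ≺_{α*} x`, `m ≤ n^s`, `m ≤ n^x`, and
`k^s(ℓ) = k^x(ℓ)` for all `ℓ < m`. -/
def SqExt (m : ℕ) (s : List Bool) (x : P.Leaf → Bool) : Prop :=
  P.SubBelow P.star (P.approx s) (P.fullLabel x) ∧ m ≤ P.nString s ∧ (m : ℕ∞) ≤ P.nPoint x ∧
    ∀ ℓ < m, P.kString s ℓ = P.kPoint x ℓ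

/-- The coding location `c^x(m)`, for finite `m ≤ n^x`: the least length of a string `s` with
`s ⊑_m x`. -/
noncomputable def codeLoc (x : P.Leaf → Bool) (m : ℕ) : ℕ :=
  sInf {l | ∃ s : List Bool, s.length = l ∧ P.SqExt m s x}

/-- The set `𝕐_α` of the points `(x,y)` such that for all `m < n^x`, the number `k^x(m)` is a code for
`y ↾ (c^x(m) + 1)`, meaning that this string is an initial segment of `M_{k^x(m)}`. -/
def Y (M : ℕ → ℕ → Bool) : Set P.Point :=
  {p | ∀ m : ℕ, (m : ℕ∞) < P.nPoint p.1 →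
    ∀ j < P.codeLoc p.1 m + 1, p.2 j = M (P.kPoint p.1 m) j}

/-- The directed graph `H_α` on `𝕐_α`: `(x,y)` is related to `(x',y')` if `x = x'`, `n^x < ω`,
`y △ y' = {c^x(n^x)}` and `c^x(n^x) ∉ y`. -/
def H (M : ℕ → ℕ → Bool) : Digraph (P.Y M) where
  Adj p q := p.1.1 = q.1.1 ∧ ∃ n : ℕ, P.nPoint p.1.1 = (n : ℕ∞) ∧
    symmDiff {j | p.1.2 j = true} {j | q.1.2 j = true} = {P.codeLoc p.1.1 n} ∧
    P.codeLoc p.1.1 n ∉ {j | p.1.2 j = true}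

end Presentation

end BorelColouring

/-! Write `α = α* + 2`. Each colour class of a `Σ⁰_α` colouring is a countable union of `Π⁰_{α*+1}`
sets, each of them a countable intersection of `Σ⁰_{α*}` sets. A colouring would therefore cover
`𝕐_α` by countably many `Π⁰_{α*+1}` sets, none containing an edge. `not_exists_cover` excludes this
by building a generic point of `𝕐_α` outside all of them.

The forcing is of Steel type: a condition is a finite partial labelling of nodes of rank at most
`α*`, used together with a finite string approximating `y`. If some extension forces a `Σ⁰_β` event,
then labels `1` of rank below `β` suffice to force it (`exists_forces_of_refines`); the low-rank
part of the extension is amalgamated with the original condition (`exists_amalgam`). In particular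
`Σ⁰_{α*}` events never require a new label `1` on a node `⟨m,k⟩`, that is, a new value `k(m)`.

A `State` fixes `k(l)` for `l < m` and the coding locations `c(l)` for `l ≤ m`. The heart is
`State.exists_refutes`. Let `⋂ j, O j` be one of the covering sets, and suppose that no extension of
a given state refutes any `O j`. Extend the state until its string has length at most `c(m)`, so
that the bit of `y` at `c(m)` is free. Along one chain of low extensions, all `O j` can be forced
for both values of this bit. No `⟨m,k⟩` receives the label `1`, so `n^x = m`, and the two resulting
points form an edge inside `⋂ j, O j`, a contradiction. Refuting each covering set is thus a dense
requirement; meeting all of them while `m` grows yields the generic point.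

For this, coding locations must exist, increase strictly and be determined by finitely much
information (`exists_sqExt`, `codeLoc_lt_succ`, `exists_finset_codeLoc`). Existence rests on
`goodStages`: by induction on `β`, the `β`-true stages of `x` are unbounded and coherent, and their
labellings exhaust `T^x_β`. Finite determination rests on `finite_support`. -/

namespace BorelColouring

/-! ### Ranks of nodes in `T_α`. -/

namespace Ladder

variable {α : Ordinal.{0}} (L : Ladder α)

theorem rankFrom_append (k : ℕ) : ∀ (σ : List ℕ) (β : Ordinal.{0}),
    L.rankFrom β (σ ++ [k]) = L.down (L.rankFrom β σ) k
  | [], _ => rfl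
  | _ :: σ, _ => rankFrom_append k σ _

theorem inTreeFrom_append (k : ℕ) : ∀ (σ : List ℕ) (β : Ordinal.{0}),
    L.InTreeFrom β (σ ++ [k]) ↔ L.InTreeFrom β σ ∧ L.rankFrom β σ ≠ 0
  | [], β => by simp [InTreeFrom, rankFrom]
  | j :: σ, β => by
    have := inTreeFrom_append k σ (L.down β j)
    simp only [List.cons_append, InTreeFrom, rankFrom, this, and_assoc]

theorem rank_append (σ : List ℕ) (k : ℕ) : L.rank (σ ++ [k]) = L.down (L.rank σ) k :=
  L.rankFrom_append k σ α

theorem inTree_append {σ : List ℕ} {k : ℕ} :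
    L.InTree (σ ++ [k]) ↔ L.InTree σ ∧ L.rank σ ≠ 0 :=
  L.inTreeFrom_append k σ α

theorem rankFrom_le : ∀ (σ : List ℕ) (β : Ordinal.{0}), β ≤ α → L.InTreeFrom β σ →
    L.rankFrom β σ ≤ β
  | [], _, _, _ => le_rfl
  | j :: σ, _, hβ, h =>
    (rankFrom_le σ _ ((L.down_lt hβ h.1 j).le.trans hβ) h.2).trans (L.down_lt hβ h.1 j).le

theorem rank_le {σ : List ℕ} (h : L.InTree σ) : L.rank σ ≤ α :=
  L.rankFrom_le σ α le_rfl h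

/-- Below a limit rank, only finitely many children have rank below a given smaller bound; below a
successor rank there are none. -/
theorem finite_children {σ : List ℕ} (hσ : L.InTree σ) {γ : Ordinal.{0}} (hγ : γ < L.rank σ) :
    {k | L.rank (σ ++ [k]) < γ}.Finite := by
  simp only [rank_append]
  have hα := L.rank_le hσ
  rcases Ordinal.zero_or_succ_or_isSuccLimit (L.rank σ) with h | ⟨δ, h⟩ | h
  · simp [h] at hγ
  · convert Set.finite_empty
    ext k
    rw [Order.succ_eq_add_one] at h
    have hδ : δ < α := lt_of_lt_of_le (by rw [← h]; exact Order.lt_succ δ) hα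
    rw [← h, Set.mem_ofPred_eq, L.down_succ δ hδ]
    rw [← h] at hγ
    simpa using Order.lt_succ_iff.1 hγ
  · obtain ⟨k₀, hk₀⟩ := L.down_cofinal _ hα h γ hγ
    refine (Set.finite_Iio k₀).subset fun k hk => ?_
    by_contra hlt
    exact absurd (hk₀.trans ((L.down_strictMono _ hα h).monotone (not_lt.1 hlt))) (not_le.2 hk)

end Ladder

namespace Presentation

open Classical

variable {α : Ordinal.{0}} (P : Presentation α)

/-! ### The labelling `T^x`, and inclusion of labellings below a rank. -/

theorem fullLabel_leaf (x : P.Leaf → Bool) {σ : List ℕ} (hσ : P.InTree σ) (h0 : P.rank σ = 0) :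
    P.fullLabel x σ = some (x ⟨σ, hσ, h0⟩) := by
  rw [fullLabel]; simp [hσ, h0]

theorem fullLabel_node (x : P.Leaf → Bool) {σ : List ℕ} (hσ : P.InTree σ) (h0 : P.rank σ ≠ 0) :
    P.fullLabel x σ =
      if ∃ k, P.fullLabel x (σ ++ [k]) = some true then some false else some true := by
  rw [fullLabel]; simp [hσ, h0]

theorem fullLabel_eq_true (x : P.Leaf → Bool) {σ : List ℕ} (hσ : P.InTree σ)
    (h0 : P.rank σ ≠ 0) :
    P.fullLabel x σ = some true ↔ ¬ ∃ k, P.fullLabel x (σ ++ [k]) = some true := by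
  rw [P.fullLabel_node x hσ h0]; split_ifs with h <;> simp [h]

theorem fullLabel_eq_false (x : P.Leaf → Bool) {σ : List ℕ} (hσ : P.InTree σ)
    (h0 : P.rank σ ≠ 0) :
    P.fullLabel x σ = some false ↔ ∃ k, P.fullLabel x (σ ++ [k]) = some true := by
  rw [P.fullLabel_node x hσ h0]; split_ifs with h <;> simp [h]

theorem fullLabel_total (x : P.Leaf → Bool) {σ : List ℕ} (hσ : P.InTree σ) :
    P.fullLabel x σ = some true ∨ P.fullLabel x σ = some false := by
  by_cases h0 : P.rank σ = 0
  · rw [P.fullLabel_leaf x hσ h0]; cases x ⟨σ, hσ, h0⟩ <;> simp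
  · rw [P.fullLabel_node x hσ h0]; split_ifs <;> simp

theorem SubBelow.refl (β : Ordinal.{0}) (f : Labelling) : P.SubBelow β f f :=
  fun _ _ _ _ h => h

variable {P} in
theorem SubBelow.trans {β : Ordinal.{0}} {f g h : Labelling} (h1 : P.SubBelow β f g)
    (h2 : P.SubBelow β g h) : P.SubBelow β f h :=
  fun σ hσ hr b hb => h2 σ hσ hr b (h1 σ hσ hr b hb)

variable {P} in
theorem SubBelow.mono {β γ : Ordinal.{0}} {f g : Labelling} (h : P.SubBelow β f g)
    (hγ : γ ≤ β) : P.SubBelow γ f g :=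
  fun σ hσ hr b hb => h σ hσ (hr.trans_le hγ) b hb

/-! ### The recursive description of `T^t` -/

/-- The lengths of the proper initial segments `s` of `t` with `T^s_β ⊆ T^t_β`. -/
noncomputable def stages (β : Ordinal.{0}) (t : List Bool) : Finset ℕ :=
  P.preds β t.length (fun i => P.approx (t.take i)) (P.approx t)

theorem mem_stages {β : Ordinal.{0}} {t : List Bool} {i : ℕ} :
    i ∈ P.stages β t ↔ i < t.length ∧ P.SubBelow β (P.approx (t.take i)) (P.approx t) := by
  simp [stages, preds]

theorem approx_unfold (t : List Bool) (σ : List ℕ) :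
    P.approx t σ = P.labelStep t (fun i => if i < t.length then P.approx (t.take i) else
      fun _ => none) (fun ρ => if P.rank ρ < P.rank σ then P.approx t ρ else none) σ := by
  conv_lhs => rw [approx, labelFrom]
  congr 1
  funext ρ
  conv_rhs => rw [approx]

theorem approx_not_inTree (t : List Bool) {σ : List ℕ} (hσ : ¬ P.InTree σ) :
    P.approx t σ = none := by
  rw [approx_unfold, labelStep]; simp [hσ]

theorem approx_leaf (t : List Bool) {σ : List ℕ} (hσ : P.InTree σ) (h0 : P.rank σ = 0) :
    P.approx t σ = t[P.pos σ]? := by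
  rw [approx_unfold, labelStep]; simp [hσ, h0]

/-- The recursion only sees labels of smaller rank and strings shorter than `t`. Both truncations
can be dropped: children have smaller rank, and once the cardinality test is passed the set of
stages is nonempty, so its supremum is an actual length below `|t|`. -/
theorem approx_node (t : List Bool) {σ : List ℕ} (hσ : P.InTree σ) (h0 : P.rank σ ≠ 0) :
    P.approx t σ =
      if (P.stages (P.rank σ) t).card ≤ P.code (P.rank σ) then none
      else if ∃ τ ∈ P.level (P.rank σ), P.pos τ < P.pos σ ∧
          Attention (P.approx (t.take ((P.stages (P.rank σ) t).sup id))) (P.approx t) τ then none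
      else if Attention (P.approx (t.take ((P.stages (P.rank σ) t).sup id))) (P.approx t) σ then
        if ∃ k, P.approx t (σ ++ [k]) = some true then some false else some true
      else P.approx (t.take ((P.stages (P.rank σ) t).sup id)) σ := by
  have hS : P.preds (P.rank σ) t.length
      (fun i => if i < t.length then P.approx (t.take i) else fun _ => none)
      (fun ρ => if P.rank ρ < P.rank σ then P.approx t ρ else none) = P.stages (P.rank σ) t := by
    ext i
    simp only [preds, stages, Finset.mem_filter, Finset.mem_range]
    refine and_congr_right fun hi => ?_
    rw [if_pos hi]
    refine forall₃_congr fun ρ _ hr => ?_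
    simp only [if_pos hr]
  have hk : ∀ τ ∈ P.level (P.rank σ), ∀ k, P.rank (τ ++ [k]) < P.rank σ := by
    rintro τ ⟨hτ, hr⟩ k
    rw [← hr]
    exact P.rank_append_lt hτ (by rw [hr]; exact h0) k
  have hatt : ∀ s : Labelling, ∀ τ ∈ P.level (P.rank σ),
      (Attention s (fun ρ => if P.rank ρ < P.rank σ then P.approx t ρ else none) τ ↔
      Attention s (P.approx t) τ) := by
    intro s τ hτ
    simp only [Attention, hk τ hτ, if_true]
  rw [approx_unfold, labelStep]
  simp only [hσ, not_true_eq_false, if_false, h0, hS]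
  by_cases hc : (P.stages (P.rank σ) t).card ≤ P.code (P.rank σ)
  · simp [hc]
  have hlt : (P.stages (P.rank σ) t).sup id < t.length := by
    have hne : (P.stages (P.rank σ) t).Nonempty := Finset.card_pos.1 (by omega)
    obtain ⟨i, hi, hi'⟩ := Finset.exists_mem_eq_sup _ hne id
    rw [hi']
    exact (P.mem_stages.1 hi).1
  simp only [hc, hlt, if_false, if_true, hk σ ⟨hσ, rfl⟩]
  have e1 : (∃ τ ∈ P.level (P.rank σ), P.pos τ < P.pos σ ∧
      Attention (P.approx (t.take ((P.stages (P.rank σ) t).sup id)))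
        (fun ρ => if P.rank ρ < P.rank σ then P.approx t ρ else none) τ) ↔
      ∃ τ ∈ P.level (P.rank σ), P.pos τ < P.pos σ ∧
      Attention (P.approx (t.take ((P.stages (P.rank σ) t).sup id))) (P.approx t) τ :=
    exists_congr fun τ => and_congr_right fun hτ => and_congr_right fun _ => hatt _ τ hτ
  simp only [e1, hatt _ σ ⟨hσ, rfl⟩]

theorem approx_nil (σ : List ℕ) : P.approx [] σ = none := by
  by_cases hσ : P.InTree σ
  · by_cases h0 : P.rank σ = 0
    · simp [P.approx_leaf [] hσ h0]
    · rw [P.approx_node [] hσ h0, if_pos]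
      have : P.stages (P.rank σ) [] = ∅ := by
        ext i; simp [mem_stages]
      simp [this]
  · exact P.approx_not_inTree _ hσ

/-- The support of `T^t` on nodes of rank below `α` is finite. -/
theorem finite_support : ∀ (n : ℕ) (t : List Bool), t.length = n →
    {σ | P.InTree σ ∧ P.rank σ < α ∧ P.approx t σ ≠ none}.Finite := by
  intro n
  induction n using Nat.strong_induction_on with
  | _ n ih =>
  intro t ht
  have hleaf : {σ | P.InTree σ ∧ P.rank σ < α ∧ P.rank σ = 0 ∧ P.pos σ < n}.Finite := by
    refine Set.Finite.of_finite_image (f := P.pos)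
      ((Set.finite_Iio n).subset (by rintro _ ⟨σ, h, rfl⟩; exact h.2.2.2)) ?_
    intro σ hσ τ hτ h
    exact (P.pos_bijOn 0 (hσ.2.2.1 ▸ hσ.2.1)).injOn ⟨hσ.1, hσ.2.2.1⟩ ⟨hτ.1, hτ.2.2.1⟩ h
  have hprev : (⋃ i ∈ Finset.range n, {σ | P.InTree σ ∧ P.rank σ < α ∧
      P.approx (t.take i) σ ≠ none}).Finite := by
    refine Set.Finite.biUnion (Finset.range n).finite_toSet fun i hi => ?_
    have hi' : i < n := by simpa using hi
    exact ih i hi' _ (by rw [List.length_take]; omega)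
  -- At most `n` stages precede `t`, so only ranks `β` with `a_β < n` can pass the cardinality test;
  -- by injectivity of `code` there are finitely many.
  have hranks : {β | β < α ∧ P.code β < n}.Finite :=
    Set.Finite.of_finite_image (f := P.code)
      ((Set.finite_Iio n).subset (by rintro _ ⟨σ, h, rfl⟩; exact h.2))
      (P.code_injOn.mono fun β h => h.1)
  -- At each such rank, the only label not copied from an earlier string belongs to the least node
  -- requiring attention.
  let A : Ordinal.{0} → Set (List ℕ) := fun β =>
    {σ ∈ P.level β | Attention (P.approx (t.take ((P.stages β t).sup id))) (P.approx t) σ ∧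
      ∀ τ ∈ P.level β, P.pos τ < P.pos σ →
      ¬ Attention (P.approx (t.take ((P.stages β t).sup id))) (P.approx t) τ}
  have hatt : (⋃ β ∈ {β | β < α ∧ P.code β < n}, A β).Finite := by
    refine Set.Finite.biUnion hranks fun β hβ => Set.Subsingleton.finite ?_
    intro σ hσ τ hτ
    refine (P.pos_bijOn β hβ.1).injOn hσ.1 hτ.1 ?_
    by_contra hne
    rcases lt_or_gt_of_ne hne with h | h
    · exact hτ.2.2 σ hσ.1 h hσ.2.1
    · exact hσ.2.2 τ hτ.1 h hτ.2.1
  refine ((hleaf.union hprev).union hatt).subset ?_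
  rintro σ ⟨hσ, hr, hd⟩
  by_cases h0 : P.rank σ = 0
  · refine Or.inl (Or.inl ⟨hσ, hr, h0, ?_⟩)
    rw [P.approx_leaf t hσ h0] at hd
    simpa [ht] using hd
  · rw [P.approx_node t hσ h0] at hd
    split_ifs at hd with h1 h2 h3 h4
    · exact absurd rfl hd
    · exact absurd rfl hd
    all_goals
      have hcard : (P.stages (P.rank σ) t).card ≤ n := by
        have : P.stages (P.rank σ) t ⊆ Finset.range n := fun i hi => by
          simpa [ht] using (P.mem_stages.1 hi).1
        simpa using Finset.card_le_card this
    · refine Or.inr (Set.mem_biUnion (x := P.rank σ) ⟨hr, by omega⟩ ⟨⟨hσ, rfl⟩, h3, ?_⟩)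
      exact fun τ hτ hp ha => h2 ⟨τ, hτ, hp, ha⟩
    · refine Or.inr (Set.mem_biUnion (x := P.rank σ) ⟨hr, by omega⟩ ⟨⟨hσ, rfl⟩, h3, ?_⟩)
      exact fun τ hτ hp ha => h2 ⟨τ, hτ, hp, ha⟩
    · refine Or.inl (Or.inr ?_)
      have hne : (P.stages (P.rank σ) t).Nonempty := Finset.card_pos.1 (by omega)
      obtain ⟨i, hi, hi'⟩ := Finset.exists_mem_eq_sup _ hne id
      refine Set.mem_biUnion (x := i) ?_ ⟨hσ, hr, ?_⟩
      · simpa [ht] using (P.mem_stages.1 hi).1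
      · rw [hi'] at hd; exact hd


/-! ### True stages of a point -/

/-- The initial segment of length `n` of `x`. -/
noncomputable def initSeg (x : P.Leaf → Bool) (n : ℕ) : List Bool :=
  (List.range n).map fun j => decide (∃ l : P.Leaf, P.pos l = j ∧ x l = true)

@[simp] theorem length_initSeg (x : P.Leaf → Bool) (n : ℕ) : (P.initSeg x n).length = n := by
  simp [initSeg]

theorem take_initSeg (x : P.Leaf → Bool) {i n : ℕ} (h : i ≤ n) :
    (P.initSeg x n).take i = P.initSeg x i := by
  rw [initSeg, ← List.map_take, List.take_range, min_eq_left h, initSeg]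

theorem approx_initSeg_leaf (h0 : 0 < α) (x : P.Leaf → Bool) (n : ℕ) (l : P.Leaf) :
    P.approx (P.initSeg x n) l = if P.pos l < n then some (x l) else none := by
  rw [P.approx_leaf _ l.2.1 l.2.2]
  split_ifs with h
  · have : decide (∃ l' : P.Leaf, P.pos l' = P.pos l ∧ x l' = true) = x l := by
      by_cases hx : x l = true
      · rw [hx]; simp only [decide_eq_true_eq]; exact ⟨l, rfl, hx⟩
      · rw [Bool.not_eq_true] at hx
        rw [hx]; simp only [decide_eq_false_iff_not]
        rintro ⟨l', hl, hl'⟩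
        have : l' = l := Subtype.ext ((P.pos_bijOn 0 h0).injOn l'.2 l.2 hl)
        rw [this, hx] at hl'
        exact absurd hl' (by decide)
    rw [initSeg, List.getElem?_map, List.getElem?_range h, Option.map_some, this]
  · simp [initSeg, h]

/-- `β`-true stages of `x`: lengths of the initial segments `s` of `x` with `T^s_β ⊆ T^x_β`. -/
def IsTrueStage (β : Ordinal.{0}) (x : P.Leaf → Bool) (i : ℕ) : Prop :=
  P.SubBelow β (P.approx (P.initSeg x i)) (P.fullLabel x)

/-- The length of the last relevant stage before stage `j` of `x`. -/
noncomputable def prevStage (β : Ordinal.{0}) (x : P.Leaf → Bool) (j : ℕ) : ℕ :=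
  (P.stages β (P.initSeg x j)).sup id

/-- The induction hypothesis of the true-stage analysis: along the `β`-true stages the labellings
increase and exhaust `T^x_β`. Coherence at `γ` identifies the stages that a `γ`-true stage takes
into account, which is what the step to `γ + 1` needs. -/
structure GoodStages (β : Ordinal.{0}) (x : P.Leaf → Bool) : Prop where
  sub : ∀ i j, i ≤ j → P.IsTrueStage β x i → P.IsTrueStage β x j →
    P.SubBelow β (P.approx (P.initSeg x i)) (P.approx (P.initSeg x j))
  unbounded : ∀ n, ∃ i, n ≤ i ∧ P.IsTrueStage β x i
  covers : ∀ σ, P.InTree σ → P.rank σ < β →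
    ∃ i, P.IsTrueStage β x i ∧ P.approx (P.initSeg x i) σ ≠ none

theorem isTrueStage_zero (β : Ordinal.{0}) (x : P.Leaf → Bool) : P.IsTrueStage β x 0 := by
  intro σ _ _ b h
  simp [initSeg, P.approx_nil] at h

theorem mem_stages_initSeg {β : Ordinal.{0}} {x : P.Leaf → Bool} {i j : ℕ} :
    i ∈ P.stages β (P.initSeg x j) ↔
      i < j ∧ P.SubBelow β (P.approx (P.initSeg x i)) (P.approx (P.initSeg x j)) := by
  rw [mem_stages, length_initSeg]
  exact and_congr_right fun h => by rw [P.take_initSeg x h.le]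

theorem prevStage_le (β : Ordinal.{0}) (x : P.Leaf → Bool) (j : ℕ) : P.prevStage β x j ≤ j :=
  Finset.sup_le fun _ hi => (P.mem_stages_initSeg.1 hi).1.le

theorem approx_initSeg_node (x : P.Leaf → Bool) (j : ℕ) {γ : Ordinal.{0}} (h0 : γ ≠ 0)
    {σ : List ℕ} (hσ : σ ∈ P.level γ) :
    P.approx (P.initSeg x j) σ =
      if (P.stages γ (P.initSeg x j)).card ≤ P.code γ then none
      else if ∃ τ ∈ P.level γ, P.pos τ < P.pos σ ∧
          Attention (P.approx (P.initSeg x (P.prevStage γ x j))) (P.approx (P.initSeg x j)) τ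
        then none
      else if Attention (P.approx (P.initSeg x (P.prevStage γ x j))) (P.approx (P.initSeg x j)) σ
        then if ∃ k, P.approx (P.initSeg x j) (σ ++ [k]) = some true then some false else some true
      else P.approx (P.initSeg x (P.prevStage γ x j)) σ := by
  obtain ⟨hσ, rfl⟩ := hσ
  rw [P.approx_node _ hσ h0, ← P.take_initSeg x (P.prevStage_le (P.rank σ) x j)]
  rfl

/-- A node is labelled only if no earlier node of its rank requires attention, and a node not
requiring attention has a label to copy. So the labelled nodes of each rank form an initial segment.
-/
theorem approx_ne_none_of_pos_le (t : List Bool) {γ : Ordinal.{0}} (h0 : γ ≠ 0) (hγ : γ < α)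
    {σ τ : List ℕ} (hσ : σ ∈ P.level γ) (hτ : τ ∈ P.level γ) (hle : P.pos τ ≤ P.pos σ)
    (hd : P.approx t σ ≠ none) : P.approx t τ ≠ none := by
  rcases hle.eq_or_lt with h | h
  · rwa [(P.pos_bijOn γ hγ).injOn hτ hσ h]
  · have e1 := P.approx_node t hσ.1 (by rw [hσ.2]; exact h0)
    have e2 := P.approx_node t hτ.1 (by rw [hτ.2]; exact h0)
    rw [hσ.2] at e1
    rw [hτ.2] at e2
    rw [e1] at hd
    split_ifs at hd with h1 h2
    · exact absurd rfl hd
    · exact absurd rfl hd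
    all_goals
      have hnτ := fun ha => h2 ⟨τ, hτ, h, ha⟩
      rw [e2, if_neg h1, if_neg, if_neg hnτ]
      · exact fun hn => hnτ (Or.inl hn)
      · rintro ⟨ρ, hρ, hlt, ha⟩
        exact h2 ⟨ρ, hρ, hlt.trans h, ha⟩

/-! ### From `γ`-true to `(γ + 1)`-true stages. -/

section Successor

variable {P} {γ : Ordinal.{0}} {x : P.Leaf → Bool}

/-- One direction composes with the inclusion into `T^x`, the other is coherence. Hence at a true
stage `prevStage` is the preceding true stage. -/
theorem GoodStages.mem_stages (H : P.GoodStages γ x) {j : ℕ} (hj : P.IsTrueStage γ x j) {i : ℕ} :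
    i ∈ P.stages γ (P.initSeg x j) ↔ i < j ∧ P.IsTrueStage γ x i := by
  rw [mem_stages_initSeg]
  exact and_congr_right fun h => ⟨fun h' => h'.trans hj, fun h' => H.sub i j h.le h' hj⟩

theorem GoodStages.prev (H : P.GoodStages γ x) {j : ℕ} (hj : P.IsTrueStage γ x j) (hpos : 0 < j) :
    P.prevStage γ x j < j ∧ P.IsTrueStage γ x (P.prevStage γ x j) ∧
      ∀ i < j, P.IsTrueStage γ x i → i ≤ P.prevStage γ x j := by
  have hne : (P.stages γ (P.initSeg x j)).Nonempty :=
    ⟨0, (H.mem_stages hj).2 ⟨hpos, P.isTrueStage_zero γ x⟩⟩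
  obtain ⟨i, hi, hi'⟩ := Finset.exists_mem_eq_sup _ hne id
  have := (H.mem_stages hj).1 hi
  rw [prevStage, hi']
  refine ⟨this.1, this.2, fun k hk hk' => ?_⟩
  rw [← hi']
  exact Finset.le_sup (f := id) ((H.mem_stages hj).2 ⟨hk, hk'⟩)

/-- A label `0` is always witnessed by a child with label `1`. -/
theorem GoodStages.witness (H : P.GoodStages γ x) (h0 : γ ≠ 0) {σ : List ℕ}
    (hσ : σ ∈ P.level γ) : ∀ j, P.IsTrueStage γ x j → P.approx (P.initSeg x j) σ = some false →
    ∃ k, P.approx (P.initSeg x j) (σ ++ [k]) = some true := by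
  intro j
  induction j using Nat.strong_induction_on with
  | _ j ih =>
  intro hj hf
  rcases Nat.eq_zero_or_pos j with rfl | hpos
  · simp [initSeg, P.approx_nil] at hf
  obtain ⟨hlt, hT, -⟩ := H.prev hj hpos
  rw [P.approx_initSeg_node x j h0 hσ] at hf
  split_ifs at hf
  · assumption
  · cases hf
  · obtain ⟨k, hk⟩ := ih _ hlt hT hf
    have hr : P.rank σ ≠ 0 := by rw [hσ.2]; exact h0
    exact ⟨k, H.sub _ _ hlt.le hT hj _ (P.inTree_append.2 ⟨hσ.1, hr⟩)
      (hσ.2 ▸ P.rank_append_lt hσ.1 hr k) _ hk⟩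

theorem GoodStages.child_eq (hγ0 : γ ≠ 0) {j : ℕ} (hj : P.IsTrueStage γ x j) {σ : List ℕ}
    (hσ : σ ∈ P.level γ) {k : ℕ} (h : P.approx (P.initSeg x j) (σ ++ [k]) = some true) :
    P.fullLabel x (σ ++ [k]) = some true := by
  have hr : P.rank σ ≠ 0 := by rw [hσ.2]; exact hγ0
  exact hj _ (P.inTree_append.2 ⟨hσ.1, hr⟩) (hσ.2 ▸ P.rank_append_lt hσ.1 hr k) _ h

/-- The child witnessing a label `0` is labelled correctly at a `γ`-true stage. So at rank `γ` only
labels `1` can be wrong. -/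
theorem GoodStages.false_correct (H : P.GoodStages γ x) (h0 : γ ≠ 0) {σ : List ℕ}
    (hσ : σ ∈ P.level γ) {j : ℕ} (hj : P.IsTrueStage γ x j)
    (hf : P.approx (P.initSeg x j) σ = some false) : P.fullLabel x σ = some false := by
  obtain ⟨k, hk⟩ := H.witness h0 hσ j hj hf
  rw [P.fullLabel_eq_false x hσ.1 (by rw [hσ.2]; exact h0)]
  exact ⟨k, child_eq h0 hj hσ hk⟩

/-- A node which has been labelled correctly does not require attention. -/
theorem GoodStages.not_attention (h0 : γ ≠ 0) {σ : List ℕ}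
    (hσ : σ ∈ P.level γ) {i j : ℕ} (hj : P.IsTrueStage γ x j)
    (hc : P.approx (P.initSeg x i) σ = P.fullLabel x σ) :
    ¬ Attention (P.approx (P.initSeg x i)) (P.approx (P.initSeg x j)) σ := by
  rintro (hn | ⟨ht, k, hk⟩)
  · rcases P.fullLabel_total x hσ.1 with h | h <;> rw [hc, h] at hn <;> cases hn
  · rw [hc, P.fullLabel_eq_true x hσ.1 (by rw [hσ.2]; exact h0)] at ht
    exact ht ⟨k, child_eq h0 hj hσ hk⟩

/-- The nodes of rank `γ` labelled at `i` form an initial segment and are labelled correctly.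
Correct labels never require attention at `γ`-true stages, so they are copied from each such stage
to the next. -/
theorem GoodStages.sub_succ (H : P.GoodStages γ x) (h0 : γ ≠ 0) (hγ : γ < α) {i : ℕ}
    (hi : P.IsTrueStage (γ + 1) x i) : ∀ j, i ≤ j → P.IsTrueStage γ x j →
    P.SubBelow (γ + 1) (P.approx (P.initSeg x i)) (P.approx (P.initSeg x j)) := by
  have hi' : P.IsTrueStage γ x i := hi.mono (Order.le_succ γ)
  intro j
  induction j using Nat.strong_induction_on with
  | _ j ih =>
  intro hij hj
  rcases hij.eq_or_lt with rfl | hlt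
  · exact SubBelow.refl P _ _
  intro σ hσ hr b hb
  rcases (Order.lt_succ_iff.1 hr).eq_or_lt with hr | hr
  swap
  · exact H.sub i j hij hi' hj σ hσ hr b hb
  have hσ' : σ ∈ P.level γ := ⟨hσ, hr⟩
  obtain ⟨p1, p2, p3⟩ := H.prev hj (by omega)
  have hip := p3 i hlt hi'
  have ih' := ih _ p1 hip p2
  have hd : P.approx (P.initSeg x i) σ ≠ none := by rw [hb]; simp
  have hcorr : ∀ τ ∈ P.level γ, P.pos τ ≤ P.pos σ →
      P.approx (P.initSeg x (P.prevStage γ x j)) τ = P.fullLabel x τ := by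
    intro τ hτ hle
    obtain ⟨b', hb'⟩ := Option.ne_none_iff_exists'.1
      (P.approx_ne_none_of_pos_le _ h0 hγ hσ' hτ hle hd)
    have hr' : P.rank τ < γ + 1 := by rw [hτ.2]; exact Order.lt_succ γ
    rw [hi τ hτ.1 hr' b' hb', ih' τ hτ.1 hr' b' hb']
  have hcard : ¬ (P.stages γ (P.initSeg x j)).card ≤ P.code γ := by
    have h1 : ¬ (P.stages γ (P.initSeg x i)).card ≤ P.code γ := by
      intro h1
      rw [P.approx_initSeg_node x i h0 hσ', if_pos h1] at hd
      exact hd rfl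
    have h2 : P.stages γ (P.initSeg x i) ⊆ P.stages γ (P.initSeg x j) := by
      intro k hk
      rw [H.mem_stages hi'] at hk
      exact (H.mem_stages hj).2 ⟨hk.1.trans hlt, hk.2⟩
    have := Finset.card_le_card h2
    omega
  rw [P.approx_initSeg_node x j h0 hσ', if_neg hcard, if_neg, if_neg]
  · exact ih' σ hσ (by rw [hr]; exact Order.lt_succ γ) b hb
  · exact not_attention h0 hσ' hj (hcorr σ hσ' le_rfl)
  · rintro ⟨τ, hτ, hlt', ha⟩
    exact not_attention h0 hτ hj (hcorr τ hτ hlt'.le) ha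

/-- The labels of the first `n` nodes of rank `γ` stabilise to the correct values. -/
theorem GoodStages.stabilise (H : P.GoodStages γ x) (h0 : γ ≠ 0) (hγ : γ < α) (n : ℕ) :
    ∃ J, ∀ j, J ≤ j → P.IsTrueStage γ x j → ∀ σ ∈ P.level γ, P.pos σ < n →
      P.approx (P.initSeg x j) σ = P.fullLabel x σ := by
  induction n with
  | zero => exact ⟨0, fun _ _ _ _ _ h => absurd h (Nat.not_lt_zero _)⟩
  | succ n ih =>
  obtain ⟨J, hJ⟩ := ih
  obtain ⟨σ, hσ, rfl⟩ := (P.pos_bijOn γ hγ).surjOn (Set.mem_univ n)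
  have hr0 : P.rank σ ≠ 0 := by rw [hσ.2]; exact h0
  have hinf : {i | P.IsTrueStage γ x i}.Infinite := by
    refine Set.infinite_of_not_bddAbove ?_
    rintro ⟨b, hb⟩
    obtain ⟨i, hi, hi'⟩ := H.unbounded (b + 1)
    have := hb hi'
    omega
  obtain ⟨S, hS, hScard⟩ := hinf.exists_subset_card_eq (P.code γ + 1)
  obtain ⟨j₁, hj₁, hj₁'⟩ := H.unbounded (J + S.sup id + 1)
  -- Past `j₁` there are more than `a_γ` earlier true stages, so the cardinality test is passed. The
  -- preceding true stage is at least `j₁`, hence beyond `J`, where all nodes before `σ` are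
  -- correct.
  have hcard : ∀ j, j₁ < j → P.IsTrueStage γ x j →
      ¬ (P.stages γ (P.initSeg x j)).card ≤ P.code γ := by
    intro j hj hT
    have : S ⊆ P.stages γ (P.initSeg x j) := by
      intro i hi
      have : i ≤ S.sup id := Finset.le_sup (f := id) hi
      exact (H.mem_stages hT).2 ⟨by omega, hS hi⟩
    have := Finset.card_le_card this
    omega
  have hform : ∀ j, j₁ < j → P.IsTrueStage γ x j → P.approx (P.initSeg x j) σ =
      if Attention (P.approx (P.initSeg x (P.prevStage γ x j))) (P.approx (P.initSeg x j)) σ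
        then if ∃ k, P.approx (P.initSeg x j) (σ ++ [k]) = some true then some false else some true
      else P.approx (P.initSeg x (P.prevStage γ x j)) σ := by
    intro j hj hT
    rw [P.approx_initSeg_node x j h0 hσ, if_neg (hcard j hj hT), if_neg]
    rintro ⟨τ, hτ, hlt, ha⟩
    obtain ⟨-, p2, p3⟩ := H.prev hT (by omega)
    have := p3 _ hj hj₁'
    exact not_attention h0 hτ hT (hJ _ (by omega) p2 τ hτ hlt) ha
  have hne : ∀ j, j₁ < j → P.IsTrueStage γ x j → P.approx (P.initSeg x j) σ ≠ none := by
    intro j hj hT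
    rw [hform j hj hT]
    split_ifs with h1 h2
    · simp
    · simp
    · exact fun h => h1 (Or.inl h)
  suffices hmain : ∃ J', ∀ j, J' ≤ j → P.IsTrueStage γ x j →
      P.approx (P.initSeg x j) σ = P.fullLabel x σ by
    obtain ⟨J', hJ'⟩ := hmain
    refine ⟨J + J', fun j hj hT τ hτ hlt => ?_⟩
    rcases (Nat.lt_succ_iff.1 hlt).eq_or_lt with h | h
    · rw [(P.pos_bijOn γ hγ).injOn hτ hσ h]
      exact hJ' j (by omega) hT
    · exact hJ j (by omega) hT τ hτ h
  -- If the correct label is `1`, a label `0` is impossible. If it is `0`, some child is eventually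
  -- labelled `1` for good, and from then on a copied label `1` at `σ` would require attention.
  rcases P.fullLabel_total x hσ.1 with hF | hF
  · refine ⟨j₁ + 1, fun j hj hT => ?_⟩
    rcases hv : P.approx (P.initSeg x j) σ with _ | b
    · exact absurd hv (hne j (by omega) hT)
    · cases b
      · exact absurd (H.false_correct h0 hσ hT hv) (by rw [hF]; simp)
      · exact hF.symm
  · obtain ⟨k, hk⟩ := (P.fullLabel_eq_false x hσ.1 hr0).1 hF
    have hkT : P.InTree (σ ++ [k]) := P.inTree_append.2 ⟨hσ.1, hr0⟩
    have hkr : P.rank (σ ++ [k]) < γ := hσ.2 ▸ P.rank_append_lt hσ.1 hr0 k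
    obtain ⟨i₀, hi₀, hd⟩ := H.covers _ hkT hkr
    have hi₀k : P.approx (P.initSeg x i₀) (σ ++ [k]) = some true := by
      obtain ⟨b, hb⟩ := Option.ne_none_iff_exists'.1 hd
      have := hi₀ _ hkT hkr b hb
      rw [hb, ← this, hk]
    refine ⟨j₁ + i₀ + 1, fun j hj hT => ?_⟩
    have hjk : P.approx (P.initSeg x j) (σ ++ [k]) = some true :=
      H.sub i₀ j (by omega) hi₀ hT _ hkT hkr _ hi₀k
    have hn := hne j (by omega) hT
    have hf := hform j (by omega) hT
    rw [hF]
    by_cases ha : Attention (P.approx (P.initSeg x (P.prevStage γ x j)))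
        (P.approx (P.initSeg x j)) σ
    · rw [hf, if_pos ha, if_pos ⟨k, hjk⟩]
    · rw [if_neg ha] at hf
      rcases hv : P.approx (P.initSeg x j) σ with _ | b
      · exact absurd hv hn
      · cases b
        · rfl
        · exact absurd (Or.inr ⟨by rw [← hf, hv], k, hjk⟩) ha

/-- For every node of rank `γ` there is a `(γ+1)`-true stage at which the labels of rank `γ` are
defined precisely before this node. -/
theorem GoodStages.exists_stage_succ (H : P.GoodStages γ x) (h0 : γ ≠ 0) (hγ : γ < α)
    {ρ : List ℕ} (hρ : ρ ∈ P.level γ) :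
    ∃ j, P.IsTrueStage (γ + 1) x j ∧ P.approx (P.initSeg x j) ρ = none ∧
      ∀ τ ∈ P.level γ, P.pos τ < P.pos ρ → P.approx (P.initSeg x j) τ ≠ none := by
  obtain ⟨J, hJ⟩ := H.stabilise h0 hγ (P.pos ρ + 1)
  have hbd : ∀ j, P.IsTrueStage γ x j ∧ P.approx (P.initSeg x j) ρ = none → j ≤ J := by
    rintro j ⟨hj, hn⟩
    by_contra hlt
    rw [hJ j (by omega) hj ρ hρ (by omega)] at hn
    rcases P.fullLabel_total x hρ.1 with h | h <;> rw [h] at hn <;> cases hn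
  have hB0 : P.IsTrueStage γ x 0 ∧ P.approx (P.initSeg x 0) ρ = none :=
    ⟨P.isTrueStage_zero γ x, by simp [initSeg, P.approx_nil]⟩
  -- The required stage is the last `γ`-true stage at which `ρ` is unlabelled. Were a node before
  -- `ρ` to require attention later, `ρ` would be unlabelled again; so the labels of rank `γ`
  -- present at `j` are final.
  obtain ⟨j, ⟨hj, hjn⟩, hmax⟩ : ∃ j, (P.IsTrueStage γ x j ∧ P.approx (P.initSeg x j) ρ = none) ∧
      ∀ i, P.IsTrueStage γ x i ∧ P.approx (P.initSeg x i) ρ = none → i ≤ j :=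
    ⟨Nat.findGreatest (fun j => P.IsTrueStage γ x j ∧ P.approx (P.initSeg x j) ρ = none) J,
      Nat.findGreatest_spec (P := fun j => P.IsTrueStage γ x j ∧
        P.approx (P.initSeg x j) ρ = none) (Nat.zero_le J) hB0,
      fun i hi => Nat.le_findGreatest (hbd i hi) hi⟩
  have hnoatt : ∀ i, j < i → P.IsTrueStage γ x i → ∀ τ ∈ P.level γ, P.pos τ < P.pos ρ →
      ¬ Attention (P.approx (P.initSeg x (P.prevStage γ x i))) (P.approx (P.initSeg x i)) τ := by
    intro i hi hT τ hτ hlt ha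
    have : P.approx (P.initSeg x i) ρ = none := by
      rw [P.approx_initSeg_node x i h0 hρ]
      by_cases hc : (P.stages γ (P.initSeg x i)).card ≤ P.code γ
      · rw [if_pos hc]
      · rw [if_neg hc, if_pos ⟨τ, hτ, hlt, ha⟩]
    have := hmax i ⟨hT, this⟩
    omega
  refine ⟨j, ?_, hjn, ?_⟩
  · have hpers : ∀ i, j ≤ i → P.IsTrueStage γ x i → ∀ τ ∈ P.level γ,
        P.approx (P.initSeg x j) τ ≠ none →
        P.approx (P.initSeg x i) τ = P.approx (P.initSeg x j) τ := by
      intro i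
      induction i using Nat.strong_induction_on with
      | _ i ih =>
      intro hij hi τ hτ hd
      rcases hij.eq_or_lt with rfl | hlt
      · rfl
      obtain ⟨p1, p2, p3⟩ := H.prev hi (by omega)
      have hposlt : P.pos τ < P.pos ρ := by
        by_contra hle
        exact P.approx_ne_none_of_pos_le _ h0 hγ hτ hρ (not_lt.1 hle) hd hjn
      have hcard : ¬ (P.stages γ (P.initSeg x i)).card ≤ P.code γ := by
        have h1 : ¬ (P.stages γ (P.initSeg x j)).card ≤ P.code γ := by
          intro h1
          rw [P.approx_initSeg_node x j h0 hτ, if_pos h1] at hd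
          exact hd rfl
        have h2 : P.stages γ (P.initSeg x j) ⊆ P.stages γ (P.initSeg x i) := by
          intro k hk
          rw [H.mem_stages hj] at hk
          exact (H.mem_stages hi).2 ⟨hk.1.trans hlt, hk.2⟩
        have := Finset.card_le_card h2
        omega
      rw [P.approx_initSeg_node x i h0 hτ, if_neg hcard, if_neg, if_neg]
      · exact ih _ p1 (p3 j hlt hj) p2 τ hτ hd
      · exact hnoatt i hlt hi τ hτ hposlt
      · rintro ⟨τ', hτ', hlt', ha⟩
        exact hnoatt i hlt hi τ' hτ' (hlt'.trans hposlt) ha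
    intro σ hσ hr b hb
    rcases (Order.lt_succ_iff.1 hr).eq_or_lt with hr | hr
    swap
    · exact hj σ hσ hr b hb
    have hσ' : σ ∈ P.level γ := ⟨hσ, hr⟩
    obtain ⟨J', hJ'⟩ := H.stabilise h0 hγ (P.pos σ + 1)
    obtain ⟨i, hi, hi'⟩ := H.unbounded (j + J')
    rw [← hJ' i (by omega) hi' σ hσ' (by omega),
      hpers i (by omega) hi' σ hσ' (by rw [hb]; simp), hb]
  · obtain ⟨i, hi, hmin⟩ : ∃ i, (j < i ∧ P.IsTrueStage γ x i) ∧
        ∀ k, j < k ∧ P.IsTrueStage γ x k → i ≤ k := by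
      have hex : ∃ i, j < i ∧ P.IsTrueStage γ x i := by
        obtain ⟨i, h1, h2⟩ := H.unbounded (j + 1)
        exact ⟨i, by omega, h2⟩
      exact ⟨Nat.find hex, Nat.find_spec hex, fun k hk => Nat.find_min' hex hk⟩
    obtain ⟨p1, p2, p3⟩ := H.prev hi.2 (by omega)
    have hpj : P.prevStage γ x i = j := by
      refine le_antisymm ?_ (p3 j hi.1 hj)
      by_contra hlt
      have := hmin _ ⟨not_le.1 hlt, p2⟩
      omega
    -- An unlabelled node before `ρ` would require attention at the next true stage.
    intro τ hτ hlt hn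
    refine hnoatt i hi.1 hi.2 τ hτ hlt (Or.inl ?_)
    rw [hpj, hn]

theorem GoodStages.succ (H : P.GoodStages γ x) (h0 : γ ≠ 0) (hγ : γ < α) :
    P.GoodStages (γ + 1) x := by
  have hunb : ∀ n, ∃ i, n ≤ i ∧ P.IsTrueStage (γ + 1) x i := by
    have hnode : ∀ n, ∃ ρ ∈ P.level γ, P.pos ρ = n := fun n =>
      (P.pos_bijOn γ hγ).surjOn (Set.mem_univ n)
    choose ρ hρ hpos using hnode
    choose f hf1 hf2 hf3 using fun n => H.exists_stage_succ h0 hγ (hρ n)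
    -- The stage for the `n`-th node labels all nodes before it but not the node itself, so
    -- different nodes give different stages.
    have hinj : Function.Injective f := by
      have : ∀ m n, m < n → f m ≠ f n := by
        intro m n hmn he
        refine hf3 n (ρ m) (hρ m) (by rw [hpos, hpos]; exact hmn) ?_
        rw [← he, hf2]
      intro m n he
      rcases lt_trichotomy m n with h | h | h
      · exact absurd he (this m n h)
      · exact h
      · exact absurd he.symm (this n m h)
    intro n
    obtain ⟨_, ⟨i, rfl⟩, hi⟩ := (Set.infinite_range_of_injective hinj).exists_gt n
    exact ⟨f i, hi.le, hf1 i⟩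
  have hmono : ∀ i, P.IsTrueStage (γ + 1) x i → P.IsTrueStage γ x i :=
    fun i h => h.mono (Order.le_succ γ)
  refine ⟨fun i j hij hi hj => H.sub_succ h0 hγ hi j hij (hmono j hj), hunb, ?_⟩
  intro σ hσ hr
  rcases (Order.lt_succ_iff.1 hr).eq_or_lt with hr | hr
  · obtain ⟨ρ, hρ, hpos⟩ := (P.pos_bijOn γ hγ).surjOn (Set.mem_univ (P.pos σ + 1))
    obtain ⟨j, h1, -, h3⟩ := H.exists_stage_succ h0 hγ hρ
    exact ⟨j, h1, h3 σ ⟨hσ, hr⟩ (by omega)⟩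
  · obtain ⟨i, hi, hd⟩ := H.covers σ hσ hr
    obtain ⟨j, hij, hj⟩ := hunb i
    obtain ⟨b, hb⟩ := Option.ne_none_iff_exists'.1 hd
    exact ⟨j, hj, by rw [H.sub i j hij hi (hmono j hj) σ hσ hr b hb]; simp⟩

end Successor

/-! ### Ranks `0` and `1`, limit ranks, and the induction on `β`. -/

theorem goodStages_zero (x : P.Leaf → Bool) : P.GoodStages 0 x where
  sub _ _ _ _ _ _ _ hr := absurd hr not_lt_zero
  unbounded n := ⟨n, le_rfl, fun _ _ hr => absurd hr not_lt_zero⟩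
  covers _ _ hr := absurd hr not_lt_zero

theorem goodStages_one (h0 : 0 < α) (x : P.Leaf → Bool) : P.GoodStages 1 x := by
  have hT : ∀ i, P.IsTrueStage 1 x i := by
    intro i σ hσ hr b hb
    rw [Order.lt_one_iff] at hr
    have := P.approx_initSeg_leaf h0 x i ⟨σ, hσ, hr⟩
    simp only at this
    rw [this] at hb
    rw [P.fullLabel_leaf x hσ hr]
    split_ifs at hb
    exact hb
  refine ⟨?_, fun n => ⟨n, le_rfl, hT n⟩, ?_⟩
  · intro i j hij _ _ σ hσ hr b hb
    rw [Order.lt_one_iff] at hr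
    have h1 := P.approx_initSeg_leaf h0 x i ⟨σ, hσ, hr⟩
    have h2 := P.approx_initSeg_leaf h0 x j ⟨σ, hσ, hr⟩
    simp only at h1 h2
    rw [h1] at hb
    split_ifs at hb with h
    rw [h2, if_pos (h.trans_le hij), hb]
  · intro σ hσ hr
    rw [Order.lt_one_iff] at hr
    refine ⟨P.pos σ + 1, hT _, ?_⟩
    have h1 := P.approx_initSeg_leaf h0 x (P.pos σ + 1) ⟨σ, hσ, hr⟩
    simp only at h1
    rw [h1, if_pos (Nat.lt_succ_self _)]
    simp

/-- If few `β`-true stages precede a `β`-true stage `i`, the cardinality test leaves every rank in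
`[β, δ)` with a large code undefined, and `i` is `δ`-true because there is nothing further to check.
Taking `β` above the finitely many ranks with code below `n` yields such a stage `i ≥ n`. -/
theorem goodStages_limit {δ : Ordinal.{0}} (hδ : Order.IsSuccLimit δ) (hδα : δ ≤ α)
    (x : P.Leaf → Bool) (H : ∀ β < δ, P.GoodStages β x) : P.GoodStages δ x := by
  have hT : ∀ i, (∀ β < δ, P.IsTrueStage β x i) → P.IsTrueStage δ x i := by
    intro i hi σ hσ hr
    exact hi (P.rank σ + 1) (hδ.succ_lt hr) σ hσ (Order.lt_succ _)
  have hunb : ∀ n, ∃ i, n ≤ i ∧ P.IsTrueStage δ x i := by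
    intro n
    have hfin : {γ | γ < δ ∧ P.code γ < n}.Finite :=
      Set.Finite.of_finite_image (f := P.code)
        ((Set.finite_Iio n).subset (by rintro _ ⟨σ, h, rfl⟩; exact h.2))
        (P.code_injOn.mono fun β h => h.1.trans_le hδα)
    have hβ : ∃ β < δ, β ≠ 0 ∧ ∀ γ, β ≤ γ → γ < δ → n ≤ P.code γ := by
      refine ⟨hfin.toFinset.sup (fun γ => γ + 1) + 1, ?_, ?_, ?_⟩
      · refine hδ.succ_lt ((Finset.sup_lt_iff hδ.bot_lt).2 fun γ hγ => ?_)
        exact hδ.succ_lt (hfin.mem_toFinset.1 hγ).1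
      · exact (Order.succ_ne_bot _)
      · intro γ h1 h2
        by_contra hlt
        have := Finset.le_sup (f := fun γ : Ordinal.{0} => γ + 1)
          (hfin.mem_toFinset.2 ⟨h2, not_le.1 hlt⟩)
        have h3 : γ < γ := calc
          γ < γ + 1 := Order.lt_succ γ
          _ ≤ _ := this
          _ ≤ _ := Order.le_succ _
          _ ≤ γ := h1
        exact lt_irrefl _ h3
    obtain ⟨β, hβδ, hβ0, hβ⟩ := hβ
    have Hβ := H β hβδ
    have hmany : ∃ i, n ≤ i ∧ P.IsTrueStage β x i ∧
        ((Finset.range i).filter fun k => P.IsTrueStage β x k).card ≤ n := by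
      have hinf : {i | P.IsTrueStage β x i}.Infinite := by
        refine Set.infinite_of_not_bddAbove ?_
        rintro ⟨b, hb⟩
        obtain ⟨i, hi, hi'⟩ := Hβ.unbounded (b + 1)
        have := hb hi'
        omega
      -- Counting from `0`, the `n`-th true stage is at least `n` and has exactly `n` true stages
      -- before it.
      refine ⟨Nat.nth (P.IsTrueStage β x) n, Nat.le_nth fun h => absurd h hinf,
        Nat.nth_mem_of_infinite hinf n, ?_⟩
      rw [← Nat.count_eq_card_filter_range, Nat.count_nth_of_infinite hinf]
    obtain ⟨i, hni, hi, hcard⟩ := hmany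
    refine ⟨i, hni, hT i fun γ hγ => ?_⟩
    induction γ using WellFoundedLT.induction with
    | _ γ ih =>
    intro σ hσ hr b hb
    by_cases hrβ : P.rank σ < β
    · exact hi σ hσ hrβ b hb
    exfalso
    have hrβ := not_lt.1 hrβ
    have hr0 : P.rank σ ≠ 0 := fun h => hβ0 (by simpa [h] using hrβ)
    have hrδ := hr.trans hγ
    rw [P.approx_initSeg_node x i hr0 ⟨hσ, rfl⟩, if_pos] at hb
    · cases hb
    refine le_trans (le_trans (Finset.card_le_card ?_) hcard) (hβ _ hrβ hrδ)
    intro k hk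
    rw [(H _ hrδ).mem_stages (ih _ hr hrδ)] at hk
    simp only [Finset.mem_filter, Finset.mem_range]
    exact ⟨hk.1, hk.2.mono hrβ⟩
  have hmono : ∀ β < δ, ∀ i, P.IsTrueStage δ x i → P.IsTrueStage β x i :=
    fun β hβ i h => h.mono hβ.le
  refine ⟨?_, hunb, ?_⟩
  · intro i j hij hi hj σ hσ hr
    have hr' : P.rank σ + 1 < δ := hδ.succ_lt hr
    exact (H _ hr').sub i j hij (hmono _ hr' i hi) (hmono _ hr' j hj) σ hσ (Order.lt_succ _)
  · intro σ hσ hr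
    have hr' : P.rank σ + 1 < δ := hδ.succ_lt hr
    obtain ⟨i, hi, hd⟩ := (H _ hr').covers σ hσ (Order.lt_succ _)
    obtain ⟨j, hij, hj⟩ := hunb i
    obtain ⟨b, hb⟩ := Option.ne_none_iff_exists'.1 hd
    refine ⟨j, hj, ?_⟩
    rw [(H _ hr').sub i j hij hi (hmono _ hr' j hj) σ hσ (Order.lt_succ _) b hb]
    simp

theorem goodStages (h0 : 0 < α) (x : P.Leaf → Bool) (β : Ordinal.{0}) (hβ : β ≤ α) :
    P.GoodStages β x := by
  induction β using WellFoundedLT.induction with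
  | _ β ih =>
  rcases Ordinal.zero_or_succ_or_isSuccLimit β with rfl | ⟨γ, rfl⟩ | h
  · exact P.goodStages_zero x
  · have hγ : γ < Order.succ γ := Order.lt_succ γ
    rw [Order.succ_eq_add_one] at hβ hγ ⊢
    rcases eq_or_ne γ 0 with rfl | hne
    · simpa using P.goodStages_one h0 x
    · exact (ih γ hγ (hγ.le.trans hβ)).succ hne (hγ.trans_le hβ)
  · exact P.goodStages_limit h hβ x fun γ hγ => ih γ hγ (hγ.le.trans hβ)


/-! ### The numbers `n`, `k` and the coding locations -/

theorem star_eq {β : Ordinal.{0}} (h : α = β + 1 + 1) : P.star = β := by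
  subst h
  simp [star]

variable {P} in
theorem star_lt (hs : α = P.star + 1 + 1) : P.star < α := by
  conv_rhs => rw [hs]
  exact (Order.lt_succ _).trans (Order.lt_succ _)

variable {P} in
theorem level_singleton (hs : α = P.star + 1 + 1) (m : ℕ) : [m] ∈ P.level (P.star + 1) := by
  have h0 : P.InTree [] := trivial
  have hr : P.rank [] = P.star + 1 + 1 := by rw [← hs]; rfl
  have h1 : P.InTree ([] ++ [m]) := P.inTree_append.2 ⟨h0, by rw [hr]; exact Order.succ_ne_bot _⟩
  refine ⟨h1, ?_⟩
  have := P.rank_append [] m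
  rw [hr, P.down_succ] at this
  · exact this
  · conv_rhs => rw [hs]
    exact Order.lt_succ _

variable {P} in
theorem level_pair (hs : α = P.star + 1 + 1) (m k : ℕ) : [m, k] ∈ P.level P.star := by
  obtain ⟨h0, hr⟩ := P.level_singleton hs m
  have h1 : P.InTree ([m] ++ [k]) := P.inTree_append.2 ⟨h0, by rw [hr]; exact Order.succ_ne_bot _⟩
  refine ⟨h1, ?_⟩
  have := P.rank_append [m] k
  rw [hr, P.down_succ] at this
  · exact this
  · exact P.star_lt hs

variable {P} in
theorem triple_inTree (hs : α = P.star + 1 + 1) (h1 : P.star ≠ 0) (m k a : ℕ) :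
    P.InTree [m, k, a] ∧ P.rank [m, k, a] < P.star := by
  obtain ⟨h0, hr⟩ := P.level_pair hs m k
  have hr0 : P.rank [m, k] ≠ 0 := by rw [hr]; exact h1
  exact ⟨P.inTree_append (σ := [m, k]).2 ⟨h0, hr0⟩, by
    have := P.rank_append_lt h0 hr0 a
    rwa [hr] at this⟩

variable {P}

theorem le_nPoint {x : P.Leaf → Bool} {m : ℕ} :
    (m : ℕ∞) ≤ P.nPoint x ↔ ∀ l < m, P.fullLabel x [l] = some false := by
  constructor
  · intro h l hl
    by_contra hne
    have : P.nPoint x ≤ (l : ℕ∞) := by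
      refine iSup₂_le fun n hn => ?_
      by_contra hlt
      exact hne (hn l (by simpa using hlt))
    have := h.trans this
    rw [Nat.cast_le] at this
    omega
  · intro h
    exact le_iSup₂_of_le m h le_rfl

theorem nPoint_eq {x : P.Leaf → Bool} {m : ℕ} (h : ∀ l < m, P.fullLabel x [l] = some false)
    (hm : P.fullLabel x [m] = some true) : P.nPoint x = m := by
  refine le_antisymm ?_ (le_nPoint.2 h)
  by_contra hlt
  have : ((m + 1 : ℕ) : ℕ∞) ≤ P.nPoint x := by
    push_cast
    exact Order.add_one_le_of_lt (not_le.1 hlt)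
  rw [le_nPoint.1 this m (Nat.lt_succ_self m)] at hm
  cases hm

theorem kPoint_spec (hs : α = P.star + 1 + 1) {x : P.Leaf → Bool} {m : ℕ}
    (h : P.fullLabel x [m] = some false) :
    P.fullLabel x [m, P.kPoint x m] = some true ∧
      ∀ k < P.kPoint x m, P.fullLabel x [m, k] = some false := by
  obtain ⟨h0, hr⟩ := P.level_singleton hs m
  have hne : {k | P.fullLabel x [m, k] = some true}.Nonempty :=
    (P.fullLabel_eq_false x h0 (by rw [hr]; exact Order.succ_ne_bot _)).1 h
  refine ⟨Nat.sInf_mem hne, fun k hk => ?_⟩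
  exact (P.fullLabel_total x (P.level_pair hs m k).1).resolve_left (Nat.notMem_of_lt_sInf hk)

theorem kPoint_eq {x : P.Leaf → Bool} {m k : ℕ} (h : P.fullLabel x [m, k] = some true)
    (h' : ∀ i < k, P.fullLabel x [m, i] = some false) : P.kPoint x m = k := by
  refine le_antisymm (Nat.sInf_le h) ?_
  by_contra hlt
  have h1 := h' _ (not_le.1 hlt)
  have h2 := Nat.sInf_mem (s := {k | P.fullLabel x [m, k] = some true}) ⟨k, h⟩
  rw [Set.mem_ofPred_eq] at h2
  rw [kPoint, h2] at h1
  cases h1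

/-- Passing from `s` to `t` only adds witnesses `a`, so candidates below `k^s(l)` stay excluded,
while `hl` keeps `k^s(l)` itself available. Hence neither infimum is over the empty set. -/
theorem kString_eq_of_sub (hs : α = P.star + 1 + 1) (h1 : P.star ≠ 0) {s t : List Bool}
    (h : P.SubBelow P.star (P.approx s) (P.approx t)) {l : ℕ}
    (hl : ¬ ∃ a, P.approx t [l, P.kString s l, a] = some true) :
    P.kString t l = P.kString s l := by
  refine le_antisymm (Nat.sInf_le hl) ?_
  by_contra hlt
  have := Nat.notMem_of_lt_sInf (not_le.1 hlt)
  rw [Set.mem_ofPred_eq, not_not] at this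
  obtain ⟨a, ha⟩ := this
  obtain ⟨h2, h3⟩ := P.triple_inTree hs h1 l (P.kString t l) a
  exact Nat.sInf_mem (s := {k | ¬ ∃ a, P.approx t [l, k, a] = some true}) ⟨_, hl⟩
    ⟨a, h _ h2 h3 _ ha⟩

theorem predLength_sub {t : List Bool} (ht : t ≠ []) :
    P.SubBelow P.star (P.approx (t.take (P.predLength t))) (P.approx t) := by
  have hne : (P.stages P.star t).Nonempty := by
    refine ⟨0, P.mem_stages.2 ⟨List.length_pos_iff.2 ht, ?_⟩⟩
    intro σ _ _ b hb
    simp [P.approx_nil] at hb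
  obtain ⟨i, hi, hi'⟩ := Finset.exists_mem_eq_sup _ hne id
  have : P.predLength t = i := hi'
  rw [this]
  exact (P.mem_stages.1 hi).2

theorem nString_nil : P.nString [] = 0 := by
  rw [nString]; simp

theorem nString_cases {t : List Bool} (ht : t ≠ []) :
    (P.nString t < P.nString (t.take (P.predLength t)) ∧
      (∃ a, P.approx t [P.nString t, P.kString (t.take (P.predLength t)) (P.nString t), a] =
        some true) ∧
      ∀ m < P.nString t, ¬ ∃ a, P.approx t [m, P.kString (t.take (P.predLength t)) m, a] =
        some true) ∨
    (P.nString t = P.nString (t.take (P.predLength t)) + 1 ∧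
      ∀ m < P.nString (t.take (P.predLength t)),
        ¬ ∃ a, P.approx t [m, P.kString (t.take (P.predLength t)) m, a] = some true) := by
  by_cases h : ∃ m < P.nString (t.take (P.predLength t)),
      ∃ a, P.approx t [m, P.kString (t.take (P.predLength t)) m, a] = some true
  · left
    have e : P.nString t = sInf {m | m < P.nString (t.take (P.predLength t)) ∧
        ∃ a, P.approx t [m, P.kString (t.take (P.predLength t)) m, a] = some true} := by
      rw [nString, dif_neg ht, if_pos h]
    have hmem := Nat.sInf_mem (s := {m | m < P.nString (t.take (P.predLength t)) ∧
        ∃ a, P.approx t [m, P.kString (t.take (P.predLength t)) m, a] = some true}) h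
    rw [← e] at hmem
    refine ⟨hmem.1, hmem.2, fun m hm ha => ?_⟩
    rw [e] at hm
    refine Nat.notMem_of_lt_sInf hm ⟨?_, ha⟩
    rw [← e] at hm
    exact hm.trans hmem.1
  · right
    refine ⟨by rw [nString, dif_neg ht, if_neg h], ?_⟩
    exact fun m hm ha => h ⟨m, hm, ha⟩

theorem sqExt_nil (x : P.Leaf → Bool) : P.SqExt 0 [] x := by
  refine ⟨?_, Nat.zero_le _, by simp, by simp⟩
  intro σ _ _ b hb
  simp [P.approx_nil] at hb

theorem SqExt.ne_nil {m : ℕ} {t : List Bool} {x : P.Leaf → Bool} (h : P.SqExt (m + 1) t x) :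
    t ≠ [] := by
  rintro rfl
  have := h.2.1
  rw [nString_nil] at this
  omega

/-- Let `s` be the predecessor of `t`. Whether `n^t < n^s` or `n^t = n^s + 1`, one has `m ≤ n^s`,
and no `k^s(l)` with `l < m` has been excluded in `t`; so `k^s(l) = k^t(l) = k^x(l)`. -/
theorem SqExt.pred (hs : α = P.star + 1 + 1) (h1 : P.star ≠ 0) {m : ℕ} {t : List Bool}
    {x : P.Leaf → Bool} (h : P.SqExt (m + 1) t x) :
    P.SqExt m (t.take (P.predLength t)) x := by
  have ht := h.ne_nil
  have hsub := P.predLength_sub ht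
  obtain ⟨hx, hm, hn, hk⟩ := h
  have hn' : (m : ℕ∞) ≤ P.nPoint x := le_trans (by exact_mod_cast Nat.le_succ m) hn
  rcases P.nString_cases ht with ⟨c1, -, c3⟩ | ⟨c1, c2⟩
  · refine ⟨hsub.trans hx, by omega, hn', fun l hl => ?_⟩
    rw [← hk l (by omega), P.kString_eq_of_sub hs h1 hsub (c3 l (by omega))]
  · refine ⟨hsub.trans hx, by omega, hn', fun l hl => ?_⟩
    rw [← hk l (by omega), P.kString_eq_of_sub hs h1 hsub (c2 l (by omega))]

/-- Along the `α*`-true stages, the strings `k^t(l)` converge to `k^x(l)`. -/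
theorem exists_kString_eq (hs : α = P.star + 1 + 1) (h1 : P.star ≠ 0) {x : P.Leaf → Bool} {m : ℕ}
    (hm : (m : ℕ∞) ≤ P.nPoint x) :
    ∃ J, ∀ j, J ≤ j → P.IsTrueStage P.star x j → ∀ l < m,
      P.kString (P.initSeg x j) l = P.kPoint x l := by
  have h0 : 0 < α := by rw [hs]; exact Order.bot_lt_succ _
  have H := P.goodStages h0 x P.star (P.star_lt hs).le
  have key : ∀ l < m, ∀ k < P.kPoint x l, ∃ J, ∀ j, J ≤ j → P.IsTrueStage P.star x j →
      ∃ a, P.approx (P.initSeg x j) [l, k, a] = some true := by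
    intro l hl k hk
    have hf := (P.kPoint_spec hs (le_nPoint.1 hm l hl)).2 k hk
    obtain ⟨hT, hr⟩ := P.level_pair hs l k
    obtain ⟨a, ha⟩ := (P.fullLabel_eq_false x hT (by rw [hr]; exact h1)).1 hf
    obtain ⟨h2, h3⟩ := P.triple_inTree hs h1 l k a
    obtain ⟨i, hi, hd⟩ := H.covers _ h2 h3
    obtain ⟨b, hb⟩ := Option.ne_none_iff_exists'.1 hd
    have e : some b = some true := by rw [← hi _ h2 h3 b hb]; exact ha
    exact ⟨i, fun j hij hj => ⟨a, H.sub i j hij hi hj _ h2 h3 true (by rw [hb, e])⟩⟩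
  choose! J hJ using key
  refine ⟨(Finset.range m).sup fun l => (Finset.range (P.kPoint x l)).sup (J l),
    fun j hj hT l hl => ?_⟩
  have hspec := (P.kPoint_spec hs (le_nPoint.1 hm l hl)).1
  obtain ⟨hT', hr⟩ := P.level_pair hs l (P.kPoint x l)
  rw [P.fullLabel_eq_true x hT' (by rw [hr]; exact h1)] at hspec
  have hmem : ¬ ∃ a, P.approx (P.initSeg x j) [l, P.kPoint x l, a] = some true := by
    rintro ⟨a, ha⟩
    obtain ⟨h2, h3⟩ := P.triple_inTree hs h1 l (P.kPoint x l) a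
    exact hspec ⟨a, hT _ h2 h3 _ ha⟩
  refine le_antisymm (Nat.sInf_le hmem) ?_
  by_contra hlt
  refine Nat.sInf_mem (s := {k | ¬ ∃ a, P.approx (P.initSeg x j) [l, k, a] = some true}) ⟨_, hmem⟩
    (hJ l hl _ (not_le.1 hlt) j (le_trans ?_ hj) hT)
  exact (Finset.le_sup (f := J l) (Finset.mem_range.2 (not_le.1 hlt))).trans
    (Finset.le_sup (f := fun l => (Finset.range (P.kPoint x l)).sup (J l)) (Finset.mem_range.2 hl))

/-- Once the values `k^s(l)`, `l < m`, have reached `k^x(l)`, no later true stage excludes them. So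
from one true stage to the next, `n^s` either grows by one or drops to a value that is still at
least `m`. -/
theorem exists_sqExt (hs : α = P.star + 1 + 1) (h1 : P.star ≠ 0) {x : P.Leaf → Bool} {m : ℕ}
    (hm : (m : ℕ∞) ≤ P.nPoint x) : ∃ s, P.SqExt m s x := by
  have h0 : 0 < α := by rw [hs]; exact Order.bot_lt_succ _
  have H := P.goodStages h0 x P.star (P.star_lt hs).le
  obtain ⟨J, hJ⟩ := P.exists_kString_eq hs h1 hm
  suffices ∃ j, J ≤ j ∧ P.IsTrueStage P.star x j ∧ m ≤ P.nString (P.initSeg x j) by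
    obtain ⟨j, hj, hT, hn⟩ := this
    exact ⟨_, hT, hn, hm, hJ j hj hT⟩
  suffices ∀ n ≤ m, ∃ j, J ≤ j ∧ P.IsTrueStage P.star x j ∧ n ≤ P.nString (P.initSeg x j) from
    this m le_rfl
  intro n
  induction n with
  | zero =>
    intro _
    obtain ⟨j, hj, hT⟩ := H.unbounded J
    exact ⟨j, hj, hT, Nat.zero_le _⟩
  | succ n ih =>
    intro hnm
    obtain ⟨i, hi, hTi, hni⟩ := ih (by omega)
    obtain ⟨j, ⟨hij, hTj⟩, hmin⟩ : ∃ j, (i < j ∧ P.IsTrueStage P.star x j) ∧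
        ∀ k, i < k ∧ P.IsTrueStage P.star x k → j ≤ k := by
      have hex : ∃ j, i < j ∧ P.IsTrueStage P.star x j := by
        obtain ⟨j, h1, h2⟩ := H.unbounded (i + 1)
        exact ⟨j, by omega, h2⟩
      exact ⟨Nat.find hex, Nat.find_spec hex, fun k hk => Nat.find_min' hex hk⟩
    obtain ⟨p1, p2, p3⟩ := H.prev hTj (by omega)
    have hp : P.predLength (P.initSeg x j) = i := by
      refine le_antisymm ?_ (p3 i hij hTi)
      by_contra hlt
      have := hmin _ ⟨not_le.1 hlt, p2⟩
      exact absurd p1 (not_lt.2 this)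
    have hne : P.initSeg x j ≠ [] := by
      rw [← List.length_pos_iff]; simp; omega
    have hnot : ∀ l < m, ¬ ∃ a, P.approx (P.initSeg x j) [l, P.kString (P.initSeg x i) l, a] =
        some true := by
      rintro l hl ⟨a, ha⟩
      rw [hJ i hi hTi l hl] at ha
      have hspec := (P.kPoint_spec hs (le_nPoint.1 hm l hl)).1
      obtain ⟨hT', hr⟩ := P.level_pair hs l (P.kPoint x l)
      rw [P.fullLabel_eq_true x hT' (by rw [hr]; exact h1)] at hspec
      obtain ⟨h2, h3⟩ := P.triple_inTree hs h1 l (P.kPoint x l) a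
      exact hspec ⟨a, hTj _ h2 h3 _ ha⟩
    refine ⟨j, by omega, hTj, ?_⟩
    have hc := P.nString_cases hne
    rw [hp, P.take_initSeg x hij.le] at hc
    rcases hc with ⟨-, c2, -⟩ | ⟨c1, -⟩
    · by_contra hlt
      exact hnot _ (by omega) c2
    · omega

theorem codeLoc_spec (hs : α = P.star + 1 + 1) (h1 : P.star ≠ 0) {x : P.Leaf → Bool} {m : ℕ}
    (hm : (m : ℕ∞) ≤ P.nPoint x) : ∃ s, s.length = P.codeLoc x m ∧ P.SqExt m s x := by
  obtain ⟨s, hs'⟩ := P.exists_sqExt hs h1 hm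
  exact Nat.sInf_mem (s := {l | ∃ s : List Bool, s.length = l ∧ P.SqExt m s x}) ⟨_, s, rfl, hs'⟩

theorem codeLoc_le {x : P.Leaf → Bool} {m : ℕ} {s : List Bool} (h : P.SqExt m s x) :
    P.codeLoc x m ≤ s.length :=
  Nat.sInf_le ⟨s, rfl, h⟩

theorem codeLoc_zero (x : P.Leaf → Bool) : P.codeLoc x 0 = 0 :=
  Nat.le_zero.1 (codeLoc_le (P.sqExt_nil x))

/-- A shortest string for `m + 1` is nonempty, and its proper initial segment from `SqExt.pred`
serves for `m`. -/
theorem codeLoc_lt_succ (hs : α = P.star + 1 + 1) (h1 : P.star ≠ 0) {x : P.Leaf → Bool} {m : ℕ}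
    (hm : ((m + 1 : ℕ) : ℕ∞) ≤ P.nPoint x) : P.codeLoc x m < P.codeLoc x (m + 1) := by
  obtain ⟨t, ht, hsq⟩ := P.codeLoc_spec hs h1 hm
  have h2 := codeLoc_le (hsq.pred hs h1)
  have h3 := P.predLength_lt hsq.ne_nil
  rw [List.length_take] at h2
  omega

/-- The coding location is determined by finitely many labels. -/
theorem exists_finset_codeLoc (hs : α = P.star + 1 + 1) (h1 : P.star ≠ 0) {x : P.Leaf → Bool}
    {m : ℕ} (hm : (m : ℕ∞) ≤ P.nPoint x) :
    ∃ F : Finset (List ℕ), (∀ σ ∈ F, P.InTree σ ∧ P.rank σ < P.star) ∧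
      ∀ x' : P.Leaf → Bool, (∀ σ ∈ F, P.fullLabel x' σ = P.fullLabel x σ) →
        (m : ℕ∞) ≤ P.nPoint x' → (∀ l < m, P.kPoint x' l = P.kPoint x l) →
        P.codeLoc x' m = P.codeLoc x m := by
  -- Only the finitely many strings of length at most `c^x(m)` compete, and each `T^s` has finite
  -- support at these ranks.
  have hfin : (⋃ s ∈ {s : List Bool | s.length ≤ P.codeLoc x m},
      {σ | P.InTree σ ∧ P.rank σ < P.star ∧ P.approx s σ ≠ none}).Finite := by
    refine Set.Finite.biUnion (List.finite_length_le Bool _) fun s _ => ?_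
    exact (P.finite_support _ s rfl).subset fun σ h => ⟨h.1, h.2.1.trans (P.star_lt hs), h.2.2⟩
  refine ⟨hfin.toFinset, ?_, ?_⟩
  · intro σ hσ
    rw [hfin.mem_toFinset] at hσ
    simp only [Set.mem_iUnion] at hσ
    obtain ⟨s, -, h2, h3, -⟩ := hσ
    exact ⟨h2, h3⟩
  · intro x' hF hm' hk
    have hiff : ∀ s : List Bool, s.length ≤ P.codeLoc x m → (P.SqExt m s x' ↔ P.SqExt m s x) := by
      intro s hsl
      have e1 : P.SubBelow P.star (P.approx s) (P.fullLabel x') ↔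
          P.SubBelow P.star (P.approx s) (P.fullLabel x) := by
        refine forall₃_congr fun σ hσ hr => forall₂_congr fun b hb => ?_
        rw [hF σ]
        rw [hfin.mem_toFinset]
        exact Set.mem_biUnion (x := s) hsl ⟨hσ, hr, by rw [hb]; simp⟩
      have e2 : (∀ l < m, P.kString s l = P.kPoint x' l) ↔ ∀ l < m, P.kString s l = P.kPoint x l :=
        forall₂_congr fun l hl => by rw [hk l hl]
      simp only [SqExt, e1, e2, hm, hm']
    obtain ⟨s, hsl, hsq⟩ := P.codeLoc_spec hs h1 hm
    -- The equivalence is available only up to length `c^x(m)`; this bound makes it applicable to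
    -- the shortest string for `x'`.
    have hle : P.codeLoc x' m ≤ P.codeLoc x m := by
      rw [← hsl]
      exact codeLoc_le ((hiff s hsl.le).2 hsq)
    refine le_antisymm hle ?_
    obtain ⟨s', hsl', hsq'⟩ := P.codeLoc_spec hs h1 hm'
    rw [← hsl']
    exact codeLoc_le ((hiff s' (by rw [hsl']; exact hle)).1 hsq')

end Presentation

/-! ### Borel codes -/

/-- Borel codes: `basic A` is a code of `A` (meant to be open), and `node f` is a code of the union
of the complements of the sets coded by the `f n`. -/
inductive BorelCode (X : Type) : Type
  | basic (A : Set X) : BorelCode X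
  | node (f : ℕ → BorelCode X) : BorelCode X

namespace BorelCode

variable {X : Type}

/-- The set coded by a Borel code. -/
def interp : BorelCode X → Set X
  | basic A => A
  | node f => ⋃ n, (interp (f n))ᶜ

/-- The code witnesses that the coded set is `Σ⁰_β`. -/
def HasRank [TopologicalSpace X] : BorelCode X → Ordinal.{0} → Prop
  | basic A, β => IsOpen A ∧ 1 ≤ β
  | node f, β => ∀ n, ∃ γ < β, HasRank (f n) γ

/-- The subcode at a given address. -/
def sub : BorelCode X → List ℕ → BorelCode X
  | c, [] => c
  | basic A, _ :: _ => basic A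
  | node f, n :: w => sub (f n) w

theorem HasRank.mono [TopologicalSpace X] {c : BorelCode X} {β γ : Ordinal.{0}}
    (h : c.HasRank β) (hβ : β ≤ γ) : c.HasRank γ := by
  cases c with
  | basic A => exact ⟨h.1, h.2.trans hβ⟩
  | node f =>
    intro n
    obtain ⟨δ, h1, h2⟩ := h n
    exact ⟨δ, h1.trans_le hβ, h2⟩

theorem HasRank.sub [TopologicalSpace X] {c : BorelCode X} :
    ∀ {β : Ordinal.{0}}, c.HasRank β → ∀ w, (c.sub w).HasRank β := by
  induction c with
  | basic A => intro β h w; cases w <;> exact h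
  | node f ih =>
    intro β h w
    cases w with
    | nil => exact h
    | cons n w =>
      obtain ⟨δ, h1, h2⟩ := h n
      exact (ih n h2 w).mono h1.le

/-- A `Σ⁰_β` subset of a subspace is the trace of a set with a code of rank `β`. -/
theorem exists_of_isSigma [TopologicalSpace X] {Y : Set X} {β : Ordinal.{0}} {A : Set Y}
    (h : IsSigma β A) : ∃ c : BorelCode X, c.HasRank β ∧ ∀ z : Y, z ∈ A ↔ z.1 ∈ c.interp := by
  induction h with
  | of_isOpen A hA =>
    obtain ⟨B, hB, rfl⟩ := isOpen_induced_iff.1 hA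
    exact ⟨basic B, ⟨hB, le_rfl⟩, fun z => Iff.rfl⟩
  | iUnion β hβ A γ h1 hlt hA ih =>
    choose c hc hcA using ih
    refine ⟨node c, fun n => ⟨γ n, hlt n, hc n⟩, fun z => ?_⟩
    simp only [interp, Set.mem_iUnion, Set.mem_compl_iff, ← hcA, not_not]

end BorelCode

/-- A chain meeting countably many dense requirements. -/
theorem exists_chain_meeting {S ι : Type*} [Countable ι] (le : S → S → Prop)
    (hrefl : ∀ s, le s s) (htrans : ∀ s t u, le s t → le t u → le s u) (D : ι → S → Prop)
    (hD : ∀ i s, ∃ t, le s t ∧ D i t) (s₀ : S) :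
    ∃ f : ℕ → S, f 0 = s₀ ∧ (∀ i j, i ≤ j → le (f i) (f j)) ∧ ∀ i, ∃ n, D i (f n) := by
  classical
  obtain ⟨e⟩ := nonempty_encodable ι
  have hstep : ∀ (n : ℕ) (s : S), ∃ t, le s t ∧ ∀ i, Encodable.decode (α := ι) n = some i →
      D i t := by
    intro n s
    rcases h : Encodable.decode (α := ι) n with _ | i
    · exact ⟨s, hrefl s, by simp⟩
    · obtain ⟨t, h1, h2⟩ := hD i s
      exact ⟨t, h1, fun j hj => by cases hj; exact h2⟩
  choose g hg1 hg2 using hstep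
  let f : ℕ → S := fun n => Nat.rec s₀ (fun n s => g n s) n
  refine ⟨f, rfl, ?_, fun i => ⟨Encodable.encode i + 1, hg2 _ _ i (Encodable.encodek i)⟩⟩
  intro i j hij
  induction hij with
  | refl => exact hrefl _
  | step _ ih => exact htrans _ _ _ ih (hg1 _ _)

namespace Presentation

open Classical

variable {α : Ordinal.{0}} (P : Presentation α)

/-! ### Forcing conditions -/

/-- A finite partial labelling of the nodes of rank at most `α*`, which does not assign the label
`1` to both a node and one of its children. -/
structure Cond where
  ones : Finset (List ℕ)
  zeros : Finset (List ℕ)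
  ones_mem : ∀ σ ∈ ones, P.InTree σ ∧ P.rank σ ≤ P.star
  zeros_mem : ∀ σ ∈ zeros, P.InTree σ ∧ P.rank σ ≤ P.star
  disj : ∀ σ ∈ ones, σ ∉ zeros
  indep : ∀ σ ∈ ones, ∀ k, σ ++ [k] ∉ ones

variable {P}

namespace Cond

/-- `p'` extends `p`. -/
def Ext (p p' : P.Cond) : Prop := p.ones ⊆ p'.ones ∧ p.zeros ⊆ p'.zeros

/-- `p'` extends `p` without adding labels `1` on nodes of rank `α*`. -/
def LowExt (p p' : P.Cond) : Prop :=
  p.Ext p' ∧ ∀ σ ∈ p'.ones, σ ∈ p.ones ∨ P.rank σ < P.star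

/-- The condition determines the label of `σ` to be `0`. -/
def Zero (p : P.Cond) (σ : List ℕ) : Prop := σ ∈ p.zeros ∨ ∃ τ ∈ p.ones, ∃ k, σ = τ ++ [k]

/-- `r` has all the information contained in `p` that is relevant for `Π⁰_β` events. -/
def Refines (β : Ordinal.{0}) (p r : P.Cond) : Prop :=
  (∀ σ ∈ p.ones, P.rank σ ≤ β → σ ∈ r.ones) ∧
  (∀ σ ∈ p.zeros, P.rank σ ≤ β → r.Zero σ) ∧
  ∀ σ ∈ p.ones, ∀ k, P.InTree (σ ++ [k]) → P.rank (σ ++ [k]) < β → r.Zero (σ ++ [k])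

theorem Ext.refl (p : P.Cond) : p.Ext p := ⟨Finset.Subset.refl _, Finset.Subset.refl _⟩

theorem Ext.trans {p q r : P.Cond} (h : p.Ext q) (h' : q.Ext r) : p.Ext r :=
  ⟨h.1.trans h'.1, h.2.trans h'.2⟩

theorem LowExt.refl (p : P.Cond) : p.LowExt p := ⟨Ext.refl p, fun _ h => Or.inl h⟩

theorem LowExt.trans {p q r : P.Cond} (h : p.LowExt q) (h' : q.LowExt r) : p.LowExt r := by
  refine ⟨h.1.trans h'.1, fun σ hσ => ?_⟩
  rcases h'.2 σ hσ with h1 | h1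
  · exact h.2 σ h1
  · exact Or.inr h1

theorem Zero.notMem {p : P.Cond} {σ : List ℕ} (h : p.Zero σ) : σ ∉ p.ones := by
  rintro h'
  rcases h with h | ⟨τ, hτ, k, rfl⟩
  · exact p.disj σ h' h
  · exact p.indep τ hτ k h'

theorem Zero.ext {p p' : P.Cond} (he : p.Ext p') {σ : List ℕ} (h : p.Zero σ) : p'.Zero σ := by
  rcases h with h | ⟨τ, hτ, k, rfl⟩
  · exact Or.inl (he.2 h)
  · exact Or.inr ⟨τ, he.1 hτ, k, rfl⟩

theorem Ext.refines {p p' : P.Cond} (h : p.Ext p') (β : Ordinal.{0}) : Refines β p p' :=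
  ⟨fun _ hσ _ => h.1 hσ, fun _ hσ _ => Or.inl (h.2 hσ),
    fun σ hσ k _ _ => Or.inr ⟨σ, h.1 hσ, k, rfl⟩⟩

theorem Refines.ext {β : Ordinal.{0}} {p r r' : P.Cond} (h : Refines β p r) (h' : r.Ext r') :
    Refines β p r' :=
  ⟨fun σ hσ hr => h'.1 (h.1 σ hσ hr), fun σ hσ hr => (h.2.1 σ hσ hr).ext h',
    fun σ hσ k hk hr => (h.2.2 σ hσ k hk hr).ext h'⟩

/-- The low-rank part of `r` can be amalgamated with `p`. -/
theorem exists_amalgam {β γ : Ordinal.{0}} (hγ : γ < β) {p r : P.Cond} (h : Refines β p r) :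
    ∃ u : P.Cond, p.Ext u ∧ (∀ σ ∈ u.ones, σ ∈ p.ones ∨ P.rank σ < β) ∧
      (∀ σ ∈ r.zeros, P.rank σ ≤ γ → σ ∈ u.zeros) ∧ Refines γ r u := by
  -- Labels `1` of `r` of rank at least `β` are not carried over, but the children of rank below `γ`
  -- which they force to be `0` must be recorded. As `γ < β`, there are finitely many.
  have hfin : (⋃ σ ∈ {σ | σ ∈ r.ones ∧ β ≤ P.rank σ},
      (fun k => σ ++ [k]) '' {k | P.rank (σ ++ [k]) < γ}).Finite := by
    refine Set.Finite.biUnion (r.ones.finite_toSet.subset fun σ hσ => hσ.1) fun σ hσ => ?_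
    exact (P.finite_children (r.ones_mem σ hσ.1).1 (hγ.trans_le hσ.2)).image _
  have hC : ∀ τ, τ ∈ hfin.toFinset ↔
      ∃ σ ∈ r.ones, β ≤ P.rank σ ∧ ∃ k, P.rank (σ ++ [k]) < γ ∧ σ ++ [k] = τ := by
    intro τ
    simp only [Set.Finite.mem_toFinset, Set.mem_iUnion, Set.mem_image, Set.mem_ofPred_eq,
      exists_prop, and_assoc]
  have hones : ∀ σ, σ ∈ p.ones ∪ r.ones.filter (fun σ => P.rank σ < β) ↔
      σ ∈ p.ones ∨ (σ ∈ r.ones ∧ P.rank σ < β) := by simp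
  have hzeros : ∀ σ, σ ∈ p.zeros ∪ r.zeros.filter (fun σ => P.rank σ ≤ γ) ∪ hfin.toFinset ↔
      σ ∈ p.zeros ∨ (σ ∈ r.zeros ∧ P.rank σ ≤ γ) ∨
        ∃ τ ∈ r.ones, β ≤ P.rank τ ∧ ∃ k, P.rank (τ ++ [k]) < γ ∧ τ ++ [k] = σ := by
    intro σ
    rw [Finset.mem_union, Finset.mem_union, Finset.mem_filter, hC, or_assoc]
  -- Any clash between the two parts would already be a clash within `r`, because `Refines β p r`
  -- transfers the relevant labels of `p` to `r`.
  refine ⟨⟨p.ones ∪ r.ones.filter (fun σ => P.rank σ < β),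
    p.zeros ∪ r.zeros.filter (fun σ => P.rank σ ≤ γ) ∪ hfin.toFinset, ?_, ?_, ?_, ?_⟩,
    ⟨?_, ?_⟩, ?_, ?_, ?_, ?_, ?_⟩
  · intro σ hσ
    rcases (hones σ).1 hσ with h1 | h1
    · exact p.ones_mem σ h1
    · exact r.ones_mem σ h1.1
  · intro σ hσ
    rcases (hzeros σ).1 hσ with h1 | h1 | ⟨τ, hτ, hr, k, hk, rfl⟩
    · exact p.zeros_mem σ h1
    · exact r.zeros_mem σ h1.1
    · obtain ⟨h1, h2⟩ := r.ones_mem τ hτ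
      exact ⟨P.inTree_append.2 ⟨h1, (bot_le.trans_lt (hγ.trans_le hr)).ne'⟩,
        hk.le.trans (hγ.le.trans (hr.trans h2))⟩
  · intro σ hσ hz
    rcases (hones σ).1 hσ with h1 | ⟨h1, h2⟩
    · rcases (hzeros σ).1 hz with h3 | ⟨h3, h4⟩ | ⟨τ, hτ, hr, k, hk, rfl⟩
      · exact p.disj σ h1 h3
      · exact r.disj σ (h.1 σ h1 (h4.trans hγ.le)) h3
      · exact r.indep τ hτ k (h.1 _ h1 (hk.le.trans hγ.le))
    · rcases (hzeros σ).1 hz with h3 | ⟨h3, -⟩ | ⟨τ, hτ, hr, k, hk, rfl⟩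
      · exact (h.2.1 σ h3 h2.le).notMem h1
      · exact r.disj σ h1 h3
      · exact r.indep τ hτ k h1
  · intro σ hσ k hk
    rcases (hones σ).1 hσ with h1 | ⟨h1, h2⟩
    · rcases (hones _).1 hk with h3 | ⟨h3, h4⟩
      · exact p.indep σ h1 k h3
      · exact (h.2.2 σ h1 k (r.ones_mem _ h3).1 h4).notMem h3
    · rcases (hones _).1 hk with h3 | ⟨h3, h4⟩
      · have hT := p.ones_mem _ h3
        have hr := P.rank_append_lt (r.ones_mem σ h1).1 (P.inTree_append.1 hT.1).2 k
        exact r.indep σ h1 k (h.1 _ h3 (hr.trans h2).le)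
      · exact r.indep σ h1 k h3
  · intro σ hσ
    exact (hones σ).2 (Or.inl hσ)
  · intro σ hσ
    exact (hzeros σ).2 (Or.inl hσ)
  · intro σ hσ
    exact ((hones σ).1 hσ).imp id And.right
  · intro σ hσ hr
    exact (hzeros σ).2 (Or.inr (Or.inl ⟨hσ, hr⟩))
  · intro σ hσ hr
    exact (hones σ).2 (Or.inr ⟨hσ, hr.trans_lt hγ⟩)
  · intro σ hσ hr
    exact Or.inl ((hzeros σ).2 (Or.inr (Or.inl ⟨hσ, hr⟩)))
  · intro σ hσ k hk hr
    rcases lt_or_ge (P.rank σ) β with h1 | h1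
    · exact Or.inr ⟨σ, (hones σ).2 (Or.inr ⟨hσ, h1⟩), k, rfl⟩
    · exact Or.inl ((hzeros _).2 (Or.inr (Or.inr ⟨σ, hσ, h1, k, hr, rfl⟩)))

/-- Only finitely many children of a node, or their children, are mentioned in a condition. -/
theorem finite_mentioned (p : P.Cond) (σ : List ℕ) :
    {a | σ ++ [a] ∈ p.ones ∪ p.zeros ∨ ∃ k, σ ++ [a] ++ [k] ∈ p.ones ∪ p.zeros}.Finite := by
  refine ((p.ones ∪ p.zeros).finite_toSet.image fun τ => τ.getD σ.length 0).subset ?_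
  rintro a (h | ⟨k, h⟩)
  · exact ⟨_, h, by simp⟩
  · exact ⟨_, h, by simp⟩

/-- Adding a label `1`. -/
theorem exists_insert_one (p : P.Cond) {σ : List ℕ} (hσ : P.InTree σ) (hr : P.rank σ ≤ P.star)
    (hz : σ ∉ p.zeros) (hc : ∀ k, σ ++ [k] ∉ p.ones) (hp : ∀ τ ∈ p.ones, ∀ k, σ ≠ τ ++ [k]) :
    ∃ p' : P.Cond, p'.ones = insert σ p.ones ∧ p'.zeros = p.zeros := by
  refine ⟨⟨insert σ p.ones, p.zeros, ?_, p.zeros_mem, ?_, ?_⟩, rfl, rfl⟩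
  · intro τ hτ
    rcases Finset.mem_insert.1 hτ with rfl | h
    · exact ⟨hσ, hr⟩
    · exact p.ones_mem τ h
  · intro τ hτ
    rcases Finset.mem_insert.1 hτ with rfl | h
    · exact hz
    · exact p.disj τ h
  · intro τ hτ k hk
    rcases Finset.mem_insert.1 hτ with rfl | h
    · rcases Finset.mem_insert.1 hk with h' | h'
      · simp at h'
      · exact hc k h'
    · rcases Finset.mem_insert.1 hk with h' | h'
      · exact hp τ h k h'.symm
      · exact p.indep τ h k h'

/-- Adding labels `0`. -/
theorem exists_union_zeros (p : P.Cond) (F : Finset (List ℕ))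
    (hF : ∀ σ ∈ F, P.InTree σ ∧ P.rank σ ≤ P.star) (hd : ∀ σ ∈ F, σ ∉ p.ones) :
    ∃ p' : P.Cond, p'.ones = p.ones ∧ p'.zeros = p.zeros ∪ F := by
  refine ⟨⟨p.ones, p.zeros ∪ F, p.ones_mem, ?_, ?_, p.indep⟩, rfl, rfl⟩
  · intro σ hσ
    rcases Finset.mem_union.1 hσ with h | h
    · exact p.zeros_mem σ h
    · exact hF σ h
  · intro σ hσ h
    rcases Finset.mem_union.1 h with h | h
    · exact p.disj σ hσ h
    · exact hd σ h hσ

/-- The label of `σ` is decided, and a label `0` of a node that is not a leaf is witnessed by a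
child with label `1`. -/
def Decides (p : P.Cond) (σ : List ℕ) : Prop :=
  σ ∈ p.ones ∨ (P.rank σ = 0 ∧ σ ∈ p.zeros) ∨ (P.rank σ ≠ 0 ∧ ∃ k, σ ++ [k] ∈ p.ones)

/-- A non-leaf receives the label `0` through a fresh child labelled `1`: neither this child nor its
children are mentioned, so nothing conflicts. The child has rank below `α*` even if `σ` has rank
`α*`, so the extension is low. -/
theorem exists_lowExt_decides (p : P.Cond) {σ : List ℕ} (hσ : P.InTree σ)
    (hr : P.rank σ ≤ P.star) : ∃ p' : P.Cond, p.LowExt p' ∧ p'.Decides σ := by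
  by_cases hone : σ ∈ p.ones
  · exact ⟨p, LowExt.refl p, Or.inl hone⟩
  by_cases h0 : P.rank σ = 0
  · obtain ⟨p', e1, e2⟩ := p.exists_union_zeros {σ} (by simpa using ⟨hσ, hr⟩) (by simpa using hone)
    refine ⟨p', ⟨⟨by rw [e1], by rw [e2]; exact Finset.subset_union_left⟩, ?_⟩,
      Or.inr (Or.inl ⟨h0, by rw [e2]; simp⟩)⟩
    intro τ hτ
    rw [e1] at hτ
    exact Or.inl hτ
  · obtain ⟨a, ha⟩ := (p.finite_mentioned σ).infinite_compl.nonempty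
    rw [Set.mem_compl_iff, Set.mem_ofPred_eq] at ha
    push Not at ha
    have hrk := (P.rank_append_lt hσ h0 a).trans_le hr
    obtain ⟨p', e1, e2⟩ := p.exists_insert_one (P.inTree_append.2 ⟨hσ, h0⟩)
      hrk.le (fun h => ha.1 (Finset.mem_union_right _ h))
      (fun k h => ha.2 k (Finset.mem_union_left _ h)) (by
        intro τ hτ k h
        obtain ⟨rfl, -⟩ := List.append_inj' h rfl
        exact hone hτ)
    refine ⟨p', ⟨⟨by rw [e1]; exact Finset.subset_insert _ _, by rw [e2]⟩, ?_⟩,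
      Or.inr (Or.inr ⟨h0, a, by rw [e1]; simp⟩)⟩
    intro τ hτ
    rw [e1] at hτ
    rcases Finset.mem_insert.1 hτ with rfl | h
    · exact Or.inr hrk
    · exact Or.inl h

/-- The labelling `T^x` agrees with the condition. -/
def Sat (p : P.Cond) (x : P.Leaf → Bool) : Prop :=
  (∀ σ ∈ p.ones, P.fullLabel x σ = some true) ∧ ∀ σ ∈ p.zeros, P.fullLabel x σ = some false

theorem Sat.of_ext {p p' : P.Cond} (h : p.Ext p') {x : P.Leaf → Bool} (hx : p'.Sat x) : p.Sat x :=
  ⟨fun σ hσ => hx.1 σ (h.1 hσ), fun σ hσ => hx.2 σ (h.2 hσ)⟩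

/-- Adding finitely many labels of `T^x` of rank below `α*`. -/
theorem Sat.exists_lowExt {p : P.Cond} {x : P.Leaf → Bool} (hx : p.Sat x) (F : Finset (List ℕ))
    (hF : ∀ σ ∈ F, P.InTree σ ∧ P.rank σ < P.star) : ∃ p' : P.Cond, p.LowExt p' ∧
      ∀ x', p'.Sat x' → ∀ σ ∈ F, P.fullLabel x' σ = P.fullLabel x σ := by
  have hones : ∀ σ, σ ∈ p.ones ∪ F.filter (fun σ => P.fullLabel x σ = some true) ↔
      σ ∈ p.ones ∨ (σ ∈ F ∧ P.fullLabel x σ = some true) := by simp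
  have hzeros : ∀ σ, σ ∈ p.zeros ∪ F.filter (fun σ => P.fullLabel x σ = some false) ↔
      σ ∈ p.zeros ∨ (σ ∈ F ∧ P.fullLabel x σ = some false) := by simp
  have ht : ∀ σ ∈ p.ones ∪ F.filter (fun σ => P.fullLabel x σ = some true),
      (P.InTree σ ∧ P.rank σ ≤ P.star) ∧ P.fullLabel x σ = some true := by
    intro σ hσ
    rcases (hones σ).1 hσ with h | h
    · exact ⟨p.ones_mem σ h, hx.1 σ h⟩
    · exact ⟨⟨(hF σ h.1).1, (hF σ h.1).2.le⟩, h.2⟩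
  have hf : ∀ σ ∈ p.zeros ∪ F.filter (fun σ => P.fullLabel x σ = some false),
      (P.InTree σ ∧ P.rank σ ≤ P.star) ∧ P.fullLabel x σ = some false := by
    intro σ hσ
    rcases (hzeros σ).1 hσ with h | h
    · exact ⟨p.zeros_mem σ h, hx.2 σ h⟩
    · exact ⟨⟨(hF σ h.1).1, (hF σ h.1).2.le⟩, h.2⟩
  refine ⟨⟨p.ones ∪ F.filter (fun σ => P.fullLabel x σ = some true),
    p.zeros ∪ F.filter (fun σ => P.fullLabel x σ = some false),
    fun σ hσ => (ht σ hσ).1, fun σ hσ => (hf σ hσ).1, ?_, ?_⟩, ⟨⟨?_, ?_⟩, ?_⟩, ?_⟩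
  · intro σ h h'
    have := (ht σ h).2
    rw [(hf σ h').2] at this
    cases this
  · intro σ h k h'
    obtain ⟨⟨h2, -⟩, h3⟩ := ht σ h
    obtain ⟨⟨h4, -⟩, h5⟩ := ht _ h'
    rw [P.fullLabel_eq_true x h2 (P.inTree_append.1 h4).2] at h3
    exact h3 ⟨k, h5⟩
  · exact Finset.subset_union_left
  · exact Finset.subset_union_left
  · intro σ hσ
    exact ((hones σ).1 hσ).imp id fun h => (hF σ h.1).2
  · intro x' hx' σ hσ
    rcases P.fullLabel_total x (hF σ hσ).1 with h | h
    · rw [h]; exact hx'.1 σ ((hones σ).2 (Or.inr ⟨hσ, h⟩))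
    · rw [h]; exact hx'.2 σ ((hzeros σ).2 (Or.inr ⟨hσ, h⟩))

end Cond

/-- The labelling of the leaves given by a chain of conditions. -/
noncomputable def chainPoint (p : ℕ → P.Cond) (l : P.Leaf) : Bool :=
  decide (∃ i, l.1 ∈ (p i).ones)

/-- A chain of conditions deciding every node of rank at most `α*`. -/
structure DecidingChain (p : ℕ → P.Cond) : Prop where
  mono : ∀ i j, i ≤ j → (p i).Ext (p j)
  decides : ∀ σ, P.InTree σ → P.rank σ ≤ P.star → ∃ i, (p i).Decides σ

/-- The chain obeys the recursion for `T^x`: a non-leaf never labelled `1` gets a child labelled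
`1`, and `indep` forbids such a child below a label `1`. Induction on the rank then identifies the
two labellings. -/
theorem DecidingChain.fullLabel {p : ℕ → P.Cond} (hp : P.DecidingChain p) :
    ∀ (β : Ordinal.{0}) (σ : List ℕ), P.rank σ = β → P.InTree σ → P.rank σ ≤ P.star →
      (P.fullLabel (P.chainPoint p) σ = some true ↔ ∃ i, σ ∈ (p i).ones) := by
  intro β
  induction β using WellFoundedLT.induction with
  | _ β ih =>
  intro σ hβ hσ hr
  by_cases h0 : P.rank σ = 0
  · rw [P.fullLabel_leaf _ hσ h0]
    simp [chainPoint]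
  have hch : ∀ k, (P.fullLabel (P.chainPoint p) (σ ++ [k]) = some true ↔
      ∃ i, σ ++ [k] ∈ (p i).ones) := by
    intro k
    have hlt := P.rank_append_lt hσ h0 k
    exact ih _ (hβ ▸ hlt) _ rfl (P.inTree_append.2 ⟨hσ, h0⟩) (hlt.le.trans hr)
  rw [P.fullLabel_eq_true _ hσ h0]
  simp only [hch]
  constructor
  · intro h
    obtain ⟨i, hi | hi | hi⟩ := hp.decides σ hσ hr
    · exact ⟨i, hi⟩
    · exact absurd hi.1 h0
    · obtain ⟨k, hk⟩ := hi.2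
      exact absurd ⟨k, i, hk⟩ h
  · rintro ⟨i, hi⟩ ⟨k, j, hj⟩
    exact (p (max i j)).indep σ ((hp.mono _ _ (le_max_left i j)).1 hi) k
      ((hp.mono _ _ (le_max_right i j)).1 hj)

theorem DecidingChain.sat {p : ℕ → P.Cond} (hp : P.DecidingChain p) (i : ℕ) :
    (p i).Sat (P.chainPoint p) := by
  constructor
  · intro σ hσ
    obtain ⟨h1, h2⟩ := (p i).ones_mem σ hσ
    exact (hp.fullLabel _ σ rfl h1 h2).2 ⟨i, hσ⟩
  · intro σ hσ
    obtain ⟨h1, h2⟩ := (p i).zeros_mem σ hσ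
    refine (P.fullLabel_total _ h1).resolve_left fun h => ?_
    obtain ⟨j, hj⟩ := (hp.fullLabel _ σ rfl h1 h2).1 h
    exact (p (max i j)).disj σ ((hp.mono _ _ (le_max_right i j)).1 hj)
      ((hp.mono _ _ (le_max_left i j)).2 hσ)

/-! ### Forcing -/

/-- The points compatible with a condition and a string. -/
def cylinder (p : P.Cond) (q : List Bool) : Set P.Point :=
  {z | (∀ l : P.Leaf, (l.1 ∈ p.ones → z.1 l = true) ∧ (l.1 ∈ p.zeros → z.1 l = false)) ∧
    ∀ j b, q[j]? = some b → z.2 j = b}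

/-- The condition `p`, with the string `q`, forces the generic point into the set coded by `c`. -/
def Forces : BorelCode P.Point → P.Cond → List Bool → Prop
  | .basic A, p, q => P.cylinder p q ⊆ A
  | .node f, p, q => ∃ n, ∀ p' q', p.Ext p' → q <+: q' → ¬ Forces (f n) p' q'

/-- No extension forces the generic point into the set coded by `c`. -/
def Refutes (c : BorelCode P.Point) (p : P.Cond) (q : List Bool) : Prop :=
  ∀ p' q', p.Ext p' → q <+: q' → ¬ P.Forces c p' q'

theorem getElem?_of_prefix {q q' : List Bool} (h : q <+: q') {j : ℕ} {b : Bool}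
    (hj : q[j]? = some b) : q'[j]? = some b := by
  obtain ⟨w, rfl⟩ := h
  rw [List.getElem?_append_left (List.getElem?_eq_some_iff.1 hj).1, hj]

theorem Forces.mono {c : BorelCode P.Point} {p p' : P.Cond} {q q' : List Bool}
    (h : P.Forces c p q) (hp : p.Ext p') (hq : q <+: q') : P.Forces c p' q' := by
  cases c with
  | basic A =>
    refine Set.Subset.trans ?_ h
    rintro z ⟨h1, h2⟩
    exact ⟨fun l => ⟨fun hl => (h1 l).1 (hp.1 hl), fun hl => (h1 l).2 (hp.2 hl)⟩,
      fun j b hj => h2 j b (getElem?_of_prefix hq hj)⟩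
  | node f =>
    obtain ⟨n, hn⟩ := h
    exact ⟨n, fun p'' q'' h1 h2 => hn p'' q'' (hp.trans h1) (hq.trans h2)⟩

/-- An extension of `p'` forcing `c` still refines `p`, so `hc` would turn it into an extension of
`p` forcing `c`. -/
theorem refutes_of_refines {c : BorelCode P.Point} {β : Ordinal.{0}} {p p' : P.Cond}
    {q : List Bool}
    (hc : ∀ (p r : P.Cond) (q : List Bool), Cond.Refines β p r → P.Forces c r q →
      ∃ u : P.Cond, p.Ext u ∧ P.Forces c u q)
    (h : P.Refutes c p q) (hp : Cond.Refines β p p') : P.Refutes c p' q := by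
  intro r q' hr hq hf
  obtain ⟨u, hu, hu'⟩ := hc p r q' (hp.ext hr) hf
  exact h u q' hu hq hu'

/-- `Σ⁰_β` events can be forced by adding only labels of rank below `β`. -/
theorem exists_forces_of_refines (c : BorelCode P.Point) : ∀ (β : Ordinal.{0}), c.HasRank β →
    ∀ (p r : P.Cond) (q : List Bool), Cond.Refines β p r → P.Forces c r q →
      ∃ u : P.Cond, p.Ext u ∧ P.Forces c u q ∧ ∀ σ ∈ u.ones, σ ∈ p.ones ∨ P.rank σ < β := by
  induction c with
  | basic A =>
    intro β hβ p r q hpr hf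
    -- A cylinder constrains only leaves, so amalgamation with `γ = 0` suffices.
    have hβ0 : 0 < β := lt_of_lt_of_le zero_lt_one hβ.2
    obtain ⟨u, h1, h2, h3, h4⟩ := Cond.exists_amalgam hβ0 hpr
    refine ⟨u, h1, Set.Subset.trans ?_ hf, h2⟩
    rintro z ⟨hz1, hz2⟩
    refine ⟨fun l => ⟨fun hl => (hz1 l).1 (h4.1 _ hl l.2.2.le), fun hl => (hz1 l).2 ?_⟩, hz2⟩
    exact h3 _ hl l.2.2.le
  | node f ih =>
    intro β hβ p r q hpr ⟨n, hn⟩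
    obtain ⟨γ, hγ, hrank⟩ := hβ n
    obtain ⟨u, h1, h2, -, h4⟩ := Cond.exists_amalgam hγ hpr
    refine ⟨u, h1, ⟨n, ?_⟩, h2⟩
    -- `u` keeps all information of `r` that matters at rank `γ`, so by induction the refutation of
    -- `f n` by `r` passes to `u`.
    refine refutes_of_refines (fun p r q h h' => ?_) hn h4
    obtain ⟨v, h5, h6, -⟩ := ih n γ hrank p r q h h'
    exact ⟨v, h5, h6⟩

/-- Events of rank at most `α*` are decided by extensions which add only labels of rank
below `α*`. -/
theorem exists_lowExt_forces {c : BorelCode P.Point} (hc : c.HasRank P.star) {p r : P.Cond}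
    {q : List Bool} (hr : p.Ext r) (hf : P.Forces c r q) :
    ∃ u : P.Cond, p.LowExt u ∧ P.Forces c u q := by
  obtain ⟨u, h1, h2, h3⟩ := P.exists_forces_of_refines c _ hc p r q (hr.refines _) hf
  exact ⟨u, ⟨h1, h3⟩, h2⟩

/-- If `c` is not refuted, some extension forces it, and its condition can be replaced by a low one
with the same string. -/
theorem exists_lowExt_decide {c : BorelCode P.Point} (hc : c.HasRank P.star) (p : P.Cond)
    (q : List Bool) : ∃ (u : P.Cond) (q' : List Bool), p.LowExt u ∧ q <+: q' ∧
      (P.Forces c u q' ∨ P.Refutes c u q') := by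
  by_cases h : P.Refutes c p q
  · exact ⟨p, q, Cond.LowExt.refl p, List.prefix_rfl, Or.inr h⟩
  · simp only [Refutes] at h
    push Not at h
    obtain ⟨r, q', hr, hq, hf⟩ := h
    obtain ⟨u, hu, hu'⟩ := P.exists_lowExt_forces hc hr hf
    exact ⟨u, q', hu, hq, Or.inl hu'⟩

/-- For a chain of conditions and strings deciding all the subcodes of a code, forcing
equals truth. -/
theorem mem_interp_iff {p : ℕ → P.Cond} (hp : P.DecidingChain p) {q : ℕ → List Bool}
    (hq : ∀ i j, i ≤ j → q i <+: q j) (hlen : ∀ n, ∃ i, n ≤ (q i).length) {y : ℕ → Bool}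
    (hy : ∀ i j b, (q i)[j]? = some b → y j = b) (c : BorelCode P.Point) :
    ∀ (β : Ordinal.{0}), c.HasRank β →
    (∀ w, ∃ i, P.Forces (c.sub w) (p i) (q i) ∨ P.Refutes (c.sub w) (p i) (q i)) →
    ((P.chainPoint p, y) ∈ c.interp ↔ ∃ i, P.Forces c (p i) (q i)) := by
  have hsat := hp.sat
  have hcyl : ∀ i, (P.chainPoint p, y) ∈ P.cylinder (p i) (q i) := by
    refine fun i => ⟨fun l => ⟨fun hl => ?_, fun hl => ?_⟩, hy i⟩
    · have := (hsat i).1 _ hl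
      rw [P.fullLabel_leaf _ l.2.1 l.2.2] at this
      exact Option.some_inj.1 this
    · have := (hsat i).2 _ hl
      rw [P.fullLabel_leaf _ l.2.1 l.2.2] at this
      exact Option.some_inj.1 this
  induction c with
  | basic A =>
    intro β hβ _
    refine ⟨fun h => ?_, fun ⟨i, hi⟩ => hi (hcyl i)⟩
    -- Membership in an open set is secured by finitely many leaves and bits; once the chain has
    -- decided these, the whole cylinder lies in `A`.
    obtain ⟨U, V, hU, hV, hxU, hyV, hUV⟩ := isOpen_prod_iff.1 hβ.1 _ _ h
    obtain ⟨I, u, hu, hIu⟩ := isOpen_pi_iff.1 hU _ hxU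
    obtain ⟨J, v, hv, hJv⟩ := isOpen_pi_iff.1 hV _ hyV
    have hleaf : ∀ l ∈ I, ∀ᶠ i in Filter.atTop, l.1 ∈ (p i).ones ∨ l.1 ∈ (p i).zeros := by
      intro l _
      obtain ⟨i, hi⟩ := hp.decides l.1 l.2.1 (by rw [l.2.2]; exact bot_le)
      filter_upwards [Filter.eventually_ge_atTop i] with j hj
      rcases hi with hi | hi | hi
      · exact Or.inl ((hp.mono i j hj).1 hi)
      · exact Or.inr ((hp.mono i j hj).2 hi.2)
      · exact absurd l.2.2 hi.1
    have hbits : ∀ n ∈ J, ∀ᶠ i in Filter.atTop, n < (q i).length := by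
      intro n _
      obtain ⟨i, hi⟩ := hlen (n + 1)
      filter_upwards [Filter.eventually_ge_atTop i] with j hj
      have := (hq i j hj).length_le
      omega
    obtain ⟨i, hi1, hi2⟩ := (((Filter.eventually_all_finset I).2 hleaf).and
      ((Filter.eventually_all_finset J).2 hbits)).exists
    refine ⟨i, fun z hz => ?_⟩
    have hzi := hcyl i
    have : z ∈ U ×ˢ V := by
      refine ⟨hIu fun l hl => ?_, hJv fun n hn => ?_⟩
      · have e : z.1 l = P.chainPoint p l := by
          rcases hi1 l hl with h1 | h1
          · rw [(hz.1 l).1 h1]; exact ((hzi.1 l).1 h1).symm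
          · rw [(hz.1 l).2 h1]; exact ((hzi.1 l).2 h1).symm
        rw [e]
        exact (hu l hl).2
      · have hb : (q i)[n]? = some ((q i)[n]'(hi2 n hn)) := List.getElem?_eq_getElem (hi2 n hn)
        have e : z.2 n = y n := by rw [hz.2 n _ hb]; exact (hzi.2 n _ hb).symm
        rw [e]
        exact (hv n hn).2
    exact hUV this
  | node f ih =>
    intro β hβ hdec
    have hdec' : ∀ n w, ∃ i, P.Forces ((f n).sub w) (p i) (q i) ∨
        P.Refutes ((f n).sub w) (p i) (q i) := fun n w => hdec (n :: w)
    have hih : ∀ n, (P.chainPoint p, y) ∈ (f n).interp ↔ ∃ i, P.Forces (f n) (p i) (q i) := by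
      intro n
      obtain ⟨γ, -, hγ⟩ := hβ n
      exact ih n γ hγ (hdec' n)
    simp only [BorelCode.interp, Set.mem_iUnion, Set.mem_compl_iff, hih]
    constructor
    · rintro ⟨n, hn⟩
      obtain ⟨i, hi⟩ := hdec' n []
      have : (f n).sub [] = f n := by cases f n <;> rfl
      rw [this] at hi
      rcases hi with hi | hi
      · exact absurd ⟨i, hi⟩ hn
      · exact ⟨i, n, hi⟩
    · rintro ⟨i, n, hn⟩
      refine ⟨n, ?_⟩
      rintro ⟨j, hj⟩
      exact hn _ _ (hp.mono i _ (le_max_left i j)) (hq i _ (le_max_left i j))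
        (hj.mono (hp.mono j _ (le_max_right i j)) (hq j _ (le_max_right i j)))

end Presentation

/-! ### Limits of strings, and codes of strings. -/

theorem exists_eq_of_prefix {a w q : List Bool} {b : Bool} (h : a ++ b :: w <+: q) :
    ∃ w', q = a ++ b :: w' ∧ w <+: w' := by
  obtain ⟨v, rfl⟩ := h
  exact ⟨w ++ v, by simp, List.prefix_append w v⟩

/-- The infinite sequence determined by a chain of strings. -/
theorem exists_limit {q : ℕ → List Bool} (hq : ∀ i j, i ≤ j → q i <+: q j) :
    ∃ y : ℕ → Bool, ∀ i j b, (q i)[j]? = some b → y j = b := by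
  classical
  refine ⟨fun j => decide (∃ i, (q i)[j]? = some true), fun i j b hb => ?_⟩
  cases b with
  | true => exact decide_eq_true ⟨i, hb⟩
  | false =>
    refine decide_eq_false ?_
    rintro ⟨k, hk⟩
    have h1 := Presentation.getElem?_of_prefix (hq i _ (le_max_left i k)) hb
    have h2 := Presentation.getElem?_of_prefix (hq k _ (le_max_right i k)) hk
    rw [h1] at h2
    cases h2

/-- In a dense sequence in Cantor space, every finite string has infinitely many codes. -/
theorem exists_code {M : ℕ → ℕ → Bool} (hM : DenseRange M) (z : ℕ → Bool) (n : ℕ) {B : Set ℕ}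
    (hB : B.Finite) : ∃ K, K ∉ B ∧ ∀ j ≤ n, M K j = z j := by
  have hopen : IsOpen {y : ℕ → Bool | ∀ j ∈ Finset.range (n + 1), y j = z j} := by
    have : {y : ℕ → Bool | ∀ j ∈ Finset.range (n + 1), y j = z j} =
        ⋂ j ∈ Finset.range (n + 1), {y : ℕ → Bool | y j = z j} := by
      ext y; simp
    rw [this]
    refine isOpen_biInter_finset fun j _ => ?_
    exact (isOpen_discrete ({z j} : Set Bool)).preimage (continuous_apply (A := fun _ : ℕ => Bool) j)
  have hinf : {y : ℕ → Bool | ∀ j ∈ Finset.range (n + 1), y j = z j}.Infinite := by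
    refine Set.infinite_of_injective_forall_mem
      (f := fun k : ℕ => fun j => if j ≤ n then z j else decide (j = n + 1 + k)) ?_ ?_
    · intro k k' h
      have := congrFun h (n + 1 + k)
      simp only [show ¬ n + 1 + k ≤ n by omega, if_false, decide_true] at this
      have := of_decide_eq_true this.symm
      omega
    · intro k j hj
      have : j ≤ n := by simpa [Nat.lt_succ_iff] using hj
      simp [this]
  -- The cylinder is open and infinite, so it remains nonempty and open after removing the finitely
  -- many points `M_k` with `k ∈ B`.
  have hne : ({y : ℕ → Bool | ∀ j ∈ Finset.range (n + 1), y j = z j} \ M '' B).Nonempty :=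
    (hinf.sdiff (hB.image M)).nonempty
  obtain ⟨K, hK1, hK2⟩ := hM.exists_mem_open (hopen.sdiff (hB.image M).isClosed) hne
  exact ⟨K, fun h => hK2 ⟨K, h, rfl⟩, fun j hj => hK1 j (by simpa [Nat.lt_succ_iff] using hj)⟩

namespace BorelCode

/-- An open set is a countable union of closed sets, so above rank `1` every code can be unfolded
once. -/
theorem HasRank.exists_node {X : Type} [TopologicalSpace X] [PerfectlyNormalSpace X]
    {c : BorelCode X} {β : Ordinal.{0}} (h : c.HasRank β) (hβ : 1 < β) :
    ∃ f : ℕ → BorelCode X, (node f).HasRank β ∧ (node f).interp = c.interp := by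
  cases c with
  | node f => exact ⟨f, h, rfl⟩
  | basic A =>
    obtain ⟨U, hU, hA⟩ := isGδ_iff_eq_iInter_nat.1 (IsClosed.isGδ h.1.isClosed_compl)
    refine ⟨fun n => basic (U n), fun n => ⟨1, hβ, hU n, le_rfl⟩, ?_⟩
    simp only [interp]
    rw [← Set.compl_iInter, ← hA, compl_compl]

end BorelCode

namespace Presentation

open Classical

variable {α : Ordinal.{0}} {P : Presentation α}

/-- The chain is generic among the low extensions of `p₀`: no label `1` of rank `α*` is ever added,
which keeps `n^x` finite in `State.exists_refutes`. -/
theorem exists_lowChain (p₀ : P.Cond) {ι : Type} [Countable ι] (D : ι → P.Cond → List Bool → Prop)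
    (hD : ∀ i p w, p₀.LowExt p → ∃ p' w', p.LowExt p' ∧ w <+: w' ∧ D i p' w') :
    ∃ (p : ℕ → P.Cond) (w : ℕ → List Bool), P.DecidingChain p ∧ p 0 = p₀ ∧
      (∀ i, p₀.LowExt (p i)) ∧ (∀ i j, i ≤ j → w i <+: w j) ∧ (∀ n, ∃ i, n ≤ (w i).length) ∧
      ∀ i, ∃ n, D i (p n) (w n) := by
  obtain ⟨f, hf0, hf, hfD⟩ := exists_chain_meeting
    (S := {s : P.Cond × List Bool // p₀.LowExt s.1}) (ι := ι ⊕ List ℕ ⊕ ℕ)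
    (fun s t => s.1.1.LowExt t.1.1 ∧ s.1.2 <+: t.1.2)
    (fun s => ⟨Cond.LowExt.refl _, List.prefix_rfl⟩)
    (fun s t u h h' => ⟨h.1.trans h'.1, h.2.trans h'.2⟩)
    (Sum.elim (fun i s => D i s.1.1 s.1.2)
      (Sum.elim (fun σ s => P.InTree σ → P.rank σ ≤ P.star → s.1.1.Decides σ)
        (fun n s => n ≤ s.1.2.length)))
    (by
      rintro (i | σ | n) ⟨⟨p, w⟩, hp⟩
      · obtain ⟨p', w', h1, h2, h3⟩ := hD i p w hp
        exact ⟨⟨(p', w'), hp.trans h1⟩, ⟨h1, h2⟩, h3⟩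
      · by_cases h : P.InTree σ ∧ P.rank σ ≤ P.star
        · obtain ⟨p', h1, h2⟩ := p.exists_lowExt_decides h.1 h.2
          exact ⟨⟨(p', w), hp.trans h1⟩, ⟨h1, List.prefix_rfl⟩, fun _ _ => h2⟩
        · exact ⟨⟨(p, w), hp⟩, ⟨Cond.LowExt.refl _, List.prefix_rfl⟩,
            fun h1 h2 => absurd ⟨h1, h2⟩ h⟩
      · exact ⟨⟨(p, w ++ List.replicate n false), hp⟩,
          ⟨Cond.LowExt.refl _, List.prefix_append _ _⟩, by simp⟩)
    ⟨(p₀, []), Cond.LowExt.refl p₀⟩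
  refine ⟨fun i => (f i).1.1, fun i => (f i).1.2, ⟨fun i j h => (hf i j h).1.1, fun σ h1 h2 => ?_⟩,
    by simp only [hf0], fun i => (f i).2, fun i j h => (hf i j h).2, fun n => hfD (.inr (.inr n)),
    fun i => hfD (.inl i)⟩
  obtain ⟨n, hn⟩ := hfD (.inr (.inl σ))
  exact ⟨n, hn h1 h2⟩

/-- In particular, the clause `loc` of a `State` is never vacuous. -/
theorem Cond.exists_sat (p : P.Cond) : ∃ x, p.Sat x := by
  obtain ⟨p', -, h1, h2, -⟩ := P.exists_lowChain p (ι := Empty) (fun i => i.elim)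
    (fun i => i.elim)
  exact ⟨_, h2 ▸ h1.sat 0⟩

/-! ### Conditions for the generic point of the graph -/

/-- A condition specifying the numbers `k(l)` for `l < m` and the coding locations for `l ≤ m`,
together with a string long enough to be coded by these numbers. -/
structure State (P : Presentation α) (M : ℕ → ℕ → Bool) where
  p : P.Cond
  q : List Bool
  m : ℕ
  κ : ℕ → ℕ
  c : ℕ → ℕ
  top : ∀ σ ∈ p.ones, P.rank σ = P.star → ∃ l < m, σ = [l, κ l]
  one_mem : ∀ l < m, [l, κ l] ∈ p.ones
  zero_mem : ∀ l < m, ∀ k < κ l, [l, k] ∈ p.zeros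
  loc : ∀ x, p.Sat x → ∀ l ≤ m, P.codeLoc x l = c l
  coded : ∀ l < m, ∀ j ≤ c l, q[j]? = some (M (κ l) j)

namespace State

variable {M : ℕ → ℕ → Bool}

/-- The coding locations need no clause, since `p` determines them through `loc`. -/
def Ext (s t : P.State M) : Prop :=
  s.p.Ext t.p ∧ s.q <+: t.q ∧ s.m ≤ t.m ∧ ∀ l < s.m, t.κ l = s.κ l

theorem Ext.refl (s : P.State M) : s.Ext s :=
  ⟨Cond.Ext.refl _, List.prefix_rfl, le_rfl, fun _ _ => rfl⟩

theorem Ext.trans {s t u : P.State M} (h : s.Ext t) (h' : t.Ext u) : s.Ext u :=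
  ⟨h.1.trans h'.1, h.2.1.trans h'.2.1, h.2.2.1.trans h'.2.2.1,
    fun l hl => (h'.2.2.2 l (hl.trans_le h.2.2.1)).trans (h.2.2.2 l hl)⟩

theorem kPoint_eq (s : P.State M) {x : P.Leaf → Bool} (hx : s.p.Sat x) {l : ℕ} (hl : l < s.m) :
    P.kPoint x l = s.κ l :=
  P.kPoint_eq (hx.1 _ (s.one_mem l hl)) fun k hk => hx.2 _ (s.zero_mem l hl k hk)

theorem fullLabel_singleton (hs : α = P.star + 1 + 1) (s : P.State M) {x : P.Leaf → Bool}
    (hx : s.p.Sat x) {l : ℕ} (hl : l < s.m) : P.fullLabel x [l] = some false := by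
  obtain ⟨h0, hr⟩ := P.level_singleton hs l
  rw [P.fullLabel_eq_false x h0 (by rw [hr]; exact Order.succ_ne_bot _)]
  exact ⟨s.κ l, hx.1 _ (s.one_mem l hl)⟩

/-- A low extension adds no label `1` of rank `α*`, so `top` survives with the same `m`, `κ` and
`c`. -/
theorem exists_lowExt (s : P.State M) {p' : P.Cond} {q' : List Bool} (hp : s.p.LowExt p')
    (hq : s.q <+: q') : ∃ t : P.State M, s.Ext t ∧ t.p = p' ∧ t.q = q' ∧ t.m = s.m ∧ t.c = s.c :=
  ⟨⟨p', q', s.m, s.κ, s.c, fun σ hσ hr => by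
      rcases hp.2 σ hσ with h | h
      · exact s.top σ h hr
      · exact absurd hr h.ne,
    fun l hl => hp.1.1 (s.one_mem l hl), fun l hl k hk => hp.1.2 (s.zero_mem l hl k hk),
    fun x hx => s.loc x (hx.of_ext hp.1),
    fun l hl j hj => getElem?_of_prefix hq (s.coded l hl j hj)⟩,
    ⟨hp.1, hq, le_rfl, fun _ _ => rfl⟩, rfl, rfl, rfl, rfl⟩

/-- The new value `k(m)` is a code `K` of `q ↾ (c(m) + 1)`, imposed by the label `1` on `⟨m,K⟩` and
`0` on the earlier siblings. The next coding location is read off from one point satisfying these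
labels and then frozen by finitely many labels of rank below `α*`. -/
theorem exists_succ (hs : α = P.star + 1 + 1) (h1 : P.star ≠ 0) (hM : DenseRange M)
    (s : P.State M) (hlen : s.c s.m < s.q.length) :
    ∃ t : P.State M, s.Ext t ∧ t.m = s.m + 1 ∧ t.q = s.q ∧ s.c s.m < t.c t.m := by
  -- Every string has infinitely many codes, so `K` can avoid the nodes mentioned in `p`. The
  -- default of `getD` plays no role, since `c(m) < |q|`.
  obtain ⟨K, hKB, hK⟩ := exists_code hM (fun j => s.q.getD j false) (s.c s.m)
    (s.p.finite_mentioned [s.m])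
  rw [Set.mem_ofPred_eq] at hKB
  push Not at hKB
  obtain ⟨hT, hr⟩ := P.level_pair hs s.m K
  obtain ⟨p1, e1, e2⟩ := s.p.exists_insert_one hT hr.le
    (fun h => hKB.1 (Finset.mem_union_right _ h)) (fun k h => hKB.2 k (Finset.mem_union_left _ h))
    (by
      intro τ hτ k h
      obtain ⟨rfl, -⟩ := List.append_inj' (show [s.m] ++ [K] = τ ++ [k] from h) rfl
      have := (s.p.ones_mem _ hτ).2
      rw [(P.level_singleton hs s.m).2] at this
      exact absurd (Order.lt_succ P.star) (not_lt.2 this))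
  have htop1 : ∀ σ ∈ p1.ones, P.rank σ = P.star → σ = [s.m, K] ∨ ∃ l < s.m, σ = [l, s.κ l] := by
    intro σ hσ hrσ
    rw [e1] at hσ
    rcases Finset.mem_insert.1 hσ with h | h
    · exact Or.inl h
    · exact Or.inr (s.top σ h hrσ)
  obtain ⟨p2, e3, e4⟩ := p1.exists_union_zeros ((Finset.range K).image fun k => [s.m, k])
    (by
      intro σ hσ
      obtain ⟨k, -, rfl⟩ := Finset.mem_image.1 hσ
      exact ⟨(P.level_pair hs s.m k).1, (P.level_pair hs s.m k).2.le⟩)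
    (by
      intro σ hσ hσ'
      obtain ⟨k, hk, rfl⟩ := Finset.mem_image.1 hσ
      have hk' := Finset.mem_range.1 hk
      rcases htop1 _ hσ' (P.level_pair hs s.m k).2 with h | ⟨l, hl, h⟩
      · simp only [List.cons.injEq, true_and, and_true] at h
        omega
      · simp only [List.cons.injEq] at h
        omega)
  obtain ⟨x, hx⟩ := p2.exists_sat
  have hone2 : [s.m, K] ∈ p2.ones := by rw [e3, e1]; exact Finset.mem_insert_self _ _
  have hzero2 : ∀ k < K, [s.m, k] ∈ p2.zeros := by
    intro k hk
    rw [e4]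
    exact Finset.mem_union_right _ (Finset.mem_image.2 ⟨k, Finset.mem_range.2 hk, rfl⟩)
  have hext2 : s.p.Ext p2 :=
    ⟨by rw [e3, e1]; exact Finset.subset_insert _ _, by
      rw [e4, e2]; exact Finset.subset_union_left⟩
  have hn : ∀ x', p2.Sat x' → ((s.m + 1 : ℕ) : ℕ∞) ≤ P.nPoint x' := by
    intro x' hx'
    refine le_nPoint.2 fun l hl => ?_
    rcases (Nat.lt_succ_iff.1 hl).eq_or_lt with rfl | h
    · obtain ⟨h0, hr⟩ := P.level_singleton hs s.m
      rw [P.fullLabel_eq_false x' h0 (by rw [hr]; exact Order.succ_ne_bot _)]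
      exact ⟨K, hx'.1 _ hone2⟩
    · exact s.fullLabel_singleton hs (hx'.of_ext hext2) h
  let κ' := Function.update s.κ s.m K
  have hκ : ∀ l < s.m, κ' l = s.κ l := fun l hl => Function.update_of_ne hl.ne _ _
  have hκm : κ' s.m = K := Function.update_self _ _ _
  have hk : ∀ x', p2.Sat x' → ∀ l < s.m + 1, P.kPoint x' l = κ' l := by
    intro x' hx' l hl
    rcases (Nat.lt_succ_iff.1 hl).eq_or_lt with rfl | h
    · rw [hκm]
      exact P.kPoint_eq (hx'.1 _ hone2) fun k hk => hx'.2 _ (hzero2 k hk)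
    · rw [hκ l h]
      exact s.kPoint_eq (hx'.of_ext hext2) h
  obtain ⟨F, hF, hFx⟩ := exists_finset_codeLoc hs h1 (hn x hx)
  obtain ⟨p3, h3, h3F⟩ := hx.exists_lowExt F hF
  have hext3 := hext2.trans h3.1
  have hlt : s.c s.m < P.codeLoc x (s.m + 1) := by
    rw [← s.loc x (hx.of_ext hext2) s.m le_rfl]
    exact codeLoc_lt_succ hs h1 (hn x hx)
  let c' := Function.update s.c (s.m + 1) (P.codeLoc x (s.m + 1))
  have hc : ∀ l ≤ s.m, c' l = s.c l := fun l hl => Function.update_of_ne (by omega) _ _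
  have hcm : c' (s.m + 1) = P.codeLoc x (s.m + 1) := Function.update_self _ _ _
  refine ⟨⟨p3, s.q, s.m + 1, κ', c', ?_, ?_, ?_, ?_, ?_⟩,
    ⟨hext3, List.prefix_rfl, Nat.le_succ _, hκ⟩, rfl, rfl, ?_⟩
  · intro σ hσ hrσ
    rcases h3.2 σ hσ with h | h
    · rw [e3] at h
      rcases htop1 σ h hrσ with rfl | ⟨l, hl, rfl⟩
      · exact ⟨s.m, Nat.lt_succ_self _, by rw [hκm]⟩
      · exact ⟨l, by omega, by rw [hκ l hl]⟩
    · exact absurd hrσ h.ne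
  · intro l hl
    rcases (Nat.lt_succ_iff.1 hl).eq_or_lt with rfl | h
    · rw [hκm]
      exact h3.1.1 hone2
    · rw [hκ l h]
      exact hext3.1 (s.one_mem l h)
  · intro l hl k hk
    rcases (Nat.lt_succ_iff.1 hl).eq_or_lt with rfl | h
    · rw [hκm] at hk
      exact h3.1.2 (hzero2 k hk)
    · rw [hκ l h] at hk
      exact hext3.2 (s.zero_mem l h k hk)
  · intro x' hx' l hl
    have hx2 := hx'.of_ext h3.1
    rcases Nat.le_succ_iff.1 hl with h | rfl
    · rw [hc l h]
      exact s.loc x' (hx'.of_ext hext3) l h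
    · rw [hcm]
      refine hFx x' (h3F x' hx') (hn x' hx2) fun l hl => ?_
      rw [hk x' hx2 l hl, hk x hx l hl]
  · intro l hl j hj
    rw [hc l (by omega)] at hj
    rcases (Nat.lt_succ_iff.1 hl).eq_or_lt with rfl | h
    · have hj' : j < s.q.length := by omega
      rw [hκm, hK j hj, List.getElem?_eq_getElem hj']
      simp [hj']
    · rw [hκ l h]
      exact s.coded l h j hj
  · change s.c s.m < c' (s.m + 1)
    rw [hcm]
    exact hlt

/-- `exists_succ` keeps the string and increases the last coding location, so finitely many
applications move that location past the string and leave its bit undetermined. -/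
theorem exists_length_le (hs : α = P.star + 1 + 1) (h1 : P.star ≠ 0) (hM : DenseRange M) :
    ∀ (n : ℕ) (s : P.State M), s.q.length - s.c s.m ≤ n →
      ∃ t : P.State M, s.Ext t ∧ t.q.length ≤ t.c t.m := by
  intro n
  induction n with
  | zero => exact fun s h => ⟨s, Ext.refl s, by omega⟩
  | succ n ih =>
    intro s h
    by_cases hle : s.q.length ≤ s.c s.m
    · exact ⟨s, Ext.refl s, hle⟩
    obtain ⟨t, h2, -, h4, h5⟩ := s.exists_succ hs h1 hM (not_le.1 hle)
    obtain ⟨u, h6, h7⟩ := ih t (by rw [h4]; omega)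
    exact ⟨u, h2.trans h6, h7⟩

theorem exists_initial (P : Presentation α) (M : ℕ → ℕ → Bool) : Nonempty (P.State M) :=
  ⟨⟨⟨∅, ∅, by simp, by simp, by simp, by simp⟩, [], 0, id, fun _ => 0, by simp, by simp, by simp,
    fun x _ l hl => by rw [Nat.le_zero.1 hl]; exact P.codeLoc_zero x, by simp⟩⟩

/-- The points of a chain of strings and conditions extending a state satisfy the coding
requirements of the state. -/
theorem coding (s : P.State M) {x : P.Leaf → Bool} (hx : s.p.Sat x) {y : ℕ → Bool}
    (hy : ∀ j b, s.q[j]? = some b → y j = b) {l : ℕ} (hl : l < s.m) :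
    ∀ j < P.codeLoc x l + 1, y j = M (P.kPoint x l) j := by
  intro j hj
  rw [s.loc x hx l hl.le] at hj
  rw [s.kPoint_eq hx hl]
  exact hy j _ (s.coded l hl j (by omega))

/-- A `Π⁰_{α*+1}` set which contains no edge of the graph is avoided by some extension of any
state. -/
theorem exists_refutes (hs : α = P.star + 1 + 1) (h1 : P.star ≠ 0) (hM : DenseRange M)
    {O : ℕ → BorelCode P.Point} (hO : ∀ j, (O j).HasRank P.star)
    (hind : ∀ z z' : P.Y M, (P.H M).Adj z z' →
      ¬ ((∀ j, z.1 ∈ (O j).interp) ∧ ∀ j, z'.1 ∈ (O j).interp)) (s₀ : P.State M) :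
    ∃ t : P.State M, s₀.Ext t ∧ ∃ j, P.Refutes (O j) t.p t.q := by
  by_contra! hcon
  obtain ⟨s, hs₀, hlen⟩ := exists_length_le hs h1 hM _ s₀ le_rfl
  -- The string is padded to length exactly `c(m)`, so the next bit `b` is the one at the coding
  -- location.
  obtain ⟨a, hqa, ha⟩ : ∃ a : List Bool, s.q <+: a ∧ a.length = s.c s.m :=
    ⟨s.q ++ List.replicate (s.c s.m - s.q.length) false, List.prefix_append _ _, by simp; omega⟩
  -- One chain of conditions and one tail `w` serve both bits `b`. The requirements with `none`
  -- force each `O j`; those with `some v` decide its subcodes.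
  obtain ⟨p, w, hp, -, hlow, hw, hwlen, hD⟩ := P.exists_lowChain s.p
    (ι := Bool × ℕ × Option (List ℕ)) (fun i p w => match i with
      | (b, j, none) => P.Forces (O j) p (a ++ b :: w)
      | (b, j, some v) => P.Forces ((O j).sub v) p (a ++ b :: w) ∨
          P.Refutes ((O j).sub v) p (a ++ b :: w))
    (by
      rintro ⟨b, j, _ | v⟩ p w hpw
      · obtain ⟨t, ht, e1, e2, -, -⟩ := s.exists_lowExt (q' := a ++ b :: w) hpw
          (hqa.trans (List.prefix_append _ _))
        have := hcon t (hs₀.trans ht) j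
        rw [e1, e2] at this
        simp only [Refutes] at this
        push Not at this
        obtain ⟨r, q', hr, hq', hf⟩ := this
        obtain ⟨w', rfl, hw'⟩ := exists_eq_of_prefix hq'
        obtain ⟨u, hu, hu'⟩ := P.exists_lowExt_forces (hO j) hr hf
        exact ⟨u, w', hu, hw', hu'⟩
      · obtain ⟨u, q', hu, hq', h⟩ := P.exists_lowExt_decide ((hO j).sub v) p (a ++ b :: w)
        obtain ⟨w', rfl, hw'⟩ := exists_eq_of_prefix hq'
        exact ⟨u, w', hu, hw', h⟩)
  have hq : ∀ b i j, i ≤ j → a ++ b :: w i <+: a ++ b :: w j := by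
    intro b i j hij
    obtain ⟨v, hv⟩ := hw i j hij
    exact ⟨v, by rw [← hv]; simp⟩
  choose y hy using fun b => exists_limit (hq b)
  have hsat : s.p.Sat (P.chainPoint p) := (hp.sat 0).of_ext (hlow 0).1
  have hmem : ∀ b j, (P.chainPoint p, y b) ∈ (O j).interp := by
    intro b j
    refine (P.mem_interp_iff hp (hq b) ?_ (hy b) (O j) _ (hO j) ?_).2 (hD (b, j, none))
    · intro n
      obtain ⟨i, hi⟩ := hwlen n
      exact ⟨i, by simp; omega⟩
    · exact fun v => hD (b, j, some v)
  -- The labels `1` of rank `α*` are those of `s`, which by `top` lie on nodes `⟨l, κ l⟩` with `l <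
  -- m`. So no `⟨m,k⟩` has label `1`, and `T^x(m) = 1`.
  have hn : P.nPoint (P.chainPoint p) = s.m := by
    refine nPoint_eq (fun l hl => s.fullLabel_singleton hs hsat hl) ?_
    obtain ⟨h0, hr⟩ := P.level_singleton hs s.m
    rw [P.fullLabel_eq_true _ h0 (by rw [hr]; exact Order.succ_ne_bot _)]
    rintro ⟨k, hk⟩
    obtain ⟨h2, hr2⟩ := P.level_pair hs s.m k
    obtain ⟨i, hi⟩ := (hp.fullLabel _ _ rfl h2 hr2.le).1 hk
    rcases (hlow i).2 _ hi with h | h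
    · obtain ⟨l, hl, he⟩ := s.top _ h hr2
      simp only [List.cons.injEq] at he
      omega
    · exact absurd hr2 h.ne
  have hyq : ∀ b j e, s.q[j]? = some e → y b j = e := fun b j e he =>
    hy b 0 j e (getElem?_of_prefix (hqa.trans (List.prefix_append _ _)) he)
  have hY : ∀ b, (P.chainPoint p, y b) ∈ P.Y M := by
    intro b l hl
    have hl' : l < s.m := by
      have hl2 : (l : ℕ∞) < P.nPoint (P.chainPoint p) := hl
      rw [hn] at hl2
      exact_mod_cast hl2
    exact s.coding hsat (hyq b) hl'
  have hloc := s.loc _ hsat s.m le_rfl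
  have hbit : ∀ b, y b (s.c s.m) = b := by
    intro b
    refine hy b 0 _ b ?_
    rw [← ha]
    simp
  have hagree : ∀ j, j ≠ s.c s.m → y false j = y true j := by
    intro j hj
    obtain ⟨i, hi⟩ := hwlen (j + 1)
    have hlt : j < (a ++ false :: w i).length := by simp; omega
    have e : (a ++ false :: w i)[j]? = (a ++ true :: w i)[j]? := by
      rw [List.getElem?_append, List.getElem?_append]
      split_ifs with h
      · rfl
      · have h3 : j - a.length = (j - a.length - 1) + 1 := by omega
        rw [h3, List.getElem?_cons_succ, List.getElem?_cons_succ]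
    have h2 := List.getElem?_eq_getElem hlt
    rw [hy false i j _ h2, hy true i j _ (e ▸ h2)]
  refine hind ⟨_, hY false⟩ ⟨_, hY true⟩ ⟨rfl, s.m, hn, ?_, ?_⟩ ⟨hmem false, hmem true⟩
  · change symmDiff {j | y false j = true} {j | y true j = true} =
      {P.codeLoc (P.chainPoint p) s.m}
    rw [hloc]
    ext j
    rw [Set.mem_symmDiff, Set.mem_singleton_iff]
    by_cases hj : j = s.c s.m
    · subst hj
      simp [hbit]
    · simp [hagree j hj, hj]
  · change ¬ (y false (P.codeLoc (P.chainPoint p) s.m) = true)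
    rw [hloc, hbit]
    simp

end State

/-- There are no countably many `Π⁰_{α*+1}` sets covering the vertices, none of which contains an
edge. -/
theorem not_exists_cover (hs : α = P.star + 1 + 1) (h1 : P.star ≠ 0) {M : ℕ → ℕ → Bool}
    (hM : DenseRange M) {ι : Type} [Countable ι] {O : ι → ℕ → BorelCode P.Point}
    (hO : ∀ n j, (O n j).HasRank P.star)
    (hind : ∀ n, ∀ z z' : P.Y M, (P.H M).Adj z z' →
      ¬ ((∀ j, z.1 ∈ (O n j).interp) ∧ ∀ j, z'.1 ∈ (O n j).interp))
    (hcover : ∀ z ∈ P.Y M, ∃ n, ∀ j, z ∈ (O n j).interp) : False := by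
  obtain ⟨s₀⟩ := State.exists_initial P M
  obtain ⟨f, -, hf, hD⟩ := exists_chain_meeting (S := P.State M)
    (ι := (List ℕ ⊕ ℕ) ⊕ ℕ ⊕ (ι × ℕ × List ℕ) ⊕ ι) State.Ext State.Ext.refl
    (fun _ _ _ h h' => h.trans h')
    (Sum.elim (Sum.elim
      (fun σ s => P.InTree σ → P.rank σ ≤ P.star → s.p.Decides σ) (fun n s => n ≤ s.q.length))
      (Sum.elim (fun m s => m < s.m) (Sum.elim
        (fun i s => P.Forces ((O i.1 i.2.1).sub i.2.2) s.p s.q ∨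
          P.Refutes ((O i.1 i.2.1).sub i.2.2) s.p s.q)
        (fun n s => ∃ j, P.Refutes (O n j) s.p s.q))))
    (by
      have hlong : ∀ n (s : P.State M), ∃ t, s.Ext t ∧ n ≤ t.q.length ∧ t.m = s.m ∧
          t.c = s.c := by
        intro n s
        obtain ⟨t, h1, -, h3, h4, h5⟩ := s.exists_lowExt
          (q' := s.q ++ List.replicate n false) (Cond.LowExt.refl _) (List.prefix_append _ _)
        exact ⟨t, h1, by rw [h3]; simp, h4, h5⟩
      rintro ((σ | n) | m | ⟨n, j, w⟩ | n) s
      · by_cases h : P.InTree σ ∧ P.rank σ ≤ P.star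
        · obtain ⟨p', h1, h2⟩ := s.p.exists_lowExt_decides h.1 h.2
          obtain ⟨t, h3, h4, -⟩ := s.exists_lowExt h1 List.prefix_rfl
          exact ⟨t, h3, fun _ _ => h4 ▸ h2⟩
        · exact ⟨s, State.Ext.refl s, fun h1 h2 => absurd ⟨h1, h2⟩ h⟩
      · obtain ⟨t, h1, h2, -⟩ := hlong n s
        exact ⟨t, h1, h2⟩
      · have hstep : ∀ m, ∃ t, s.Ext t ∧ m ≤ t.m := by
          intro m
          induction m with
          | zero => exact ⟨s, State.Ext.refl s, Nat.zero_le _⟩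
          | succ m ih =>
            obtain ⟨t, h2, h3⟩ := ih
            -- `exists_succ` needs a string reaching past `c(m)`.
            obtain ⟨u, h4, h5, h6, h7⟩ := hlong (t.c t.m + 1) t
            obtain ⟨v, h8, h9, -⟩ := u.exists_succ hs h1 hM (by rw [h6, h7]; omega)
            exact ⟨v, (h2.trans h4).trans h8, by omega⟩
        exact hstep (m + 1)
      · obtain ⟨u, q', hu, hq, h⟩ := P.exists_lowExt_decide ((hO n j).sub w) s.p s.q
        obtain ⟨t, h2, rfl, rfl, -⟩ := s.exists_lowExt hu hq
        exact ⟨t, h2, h⟩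
      · exact s.exists_refutes hs h1 hM (hO n) (hind n))
    s₀
  have hp : P.DecidingChain fun i => (f i).p := by
    refine ⟨fun i j h => (hf i j h).1, fun σ h2 h3 => ?_⟩
    obtain ⟨n, hn⟩ := hD (.inl (.inl σ))
    exact ⟨n, hn h2 h3⟩
  have hq : ∀ i j, i ≤ j → (f i).q <+: (f j).q := fun i j h => (hf i j h).2.1
  obtain ⟨y, hy⟩ := exists_limit hq
  have hY : (P.chainPoint fun i => (f i).p, y) ∈ P.Y M := by
    intro m _
    obtain ⟨i, hi⟩ := hD (.inr (.inl m))
    exact (f i).coding (hp.sat i) (hy i) hi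
  -- The generic point lies in all `O n j` for this `n`, so each of them is forced along the chain;
  -- but one of them has been refuted.
  obtain ⟨n, hn⟩ := hcover _ hY
  obtain ⟨i, j, hij⟩ := hD (.inr (.inr (.inr n)))
  obtain ⟨k, hk⟩ := (P.mem_interp_iff hp hq (fun n => hD (.inl (.inr n))) hy (O n j) _ (hO n j)
    fun w => hD (.inr (.inr (.inl (n, j, w))))).1 (hn j)
  exact hij _ _ (hp.mono i _ (le_max_left i k)) (hq i _ (le_max_left i k))
    (hk.mono (hp.mono k _ (le_max_right i k)) (hq k _ (le_max_right i k)))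

end Presentation

end BorelColouring

/-! ### From a colouring to a cover by edge-free `Π⁰_{α*+1}` sets. -/

theorem mainTheorem2 (α : Ordinal.{0}) (hα : 3 ≤ α) (hsucc : ∃ β : Ordinal.{0}, α = β + 1 + 1)
    (P : BorelColouring.Presentation α) (M : ℕ → ℕ → Bool) (hM : DenseRange M) :
    ¬ BorelColouring.HasCountableSigmaColouring α (P.H M) := by
  obtain ⟨β, hβ⟩ := hsucc
  have hs : α = P.star + 1 + 1 := by rw [P.star_eq hβ]; exact hβ
  -- This is where `3 ≤ α` enters: `α* = 0` would give `α = 2`.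
  have h1 : P.star ≠ 0 := by
    rintro h
    rw [h] at hs
    rw [hs] at hα
    norm_num at hα
  have hpos : (1 : Ordinal.{0}) < P.star + 1 := by
    conv_lhs => rw [← zero_add (1 : Ordinal.{0})]
    exact Order.succ_lt_succ (pos_iff_ne_zero.2 h1)
  rintro ⟨c, hc, hadj⟩
  choose d hd hdc using fun n => BorelColouring.BorelCode.exists_of_isSigma (hc n)
  -- Two unfoldings lower the rank from `α` to `α*`: a class is `⋃ k, (f n k)ᶜ`, and each `(f n k)ᶜ`
  -- is `⋂ j, g n k j`.
  have hnode : ∀ n, ∃ f : ℕ → BorelColouring.BorelCode P.Point,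
      (∀ k, (f k).HasRank (P.star + 1)) ∧
      (BorelColouring.BorelCode.node f).interp = (d n).interp := by
    intro n
    have hα1 : 1 < α := hpos.trans (by
      conv_rhs => rw [hs]
      exact Order.lt_succ _)
    obtain ⟨f, h2, h3⟩ := (hd n).exists_node hα1
    refine ⟨f, fun k => ?_, h3⟩
    obtain ⟨γ, h4, h5⟩ := h2 k
    exact h5.mono (Order.lt_succ_iff.1 (by rw [hs] at h4; exact h4))
  choose f hf hfd using hnode
  have hnode' : ∀ n k, ∃ g : ℕ → BorelColouring.BorelCode P.Point,
      (∀ j, (g j).HasRank P.star) ∧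
      (BorelColouring.BorelCode.node g).interp = (f n k).interp := by
    intro n k
    obtain ⟨g, h2, h3⟩ := (hf n k).exists_node hpos
    refine ⟨g, fun j => ?_, h3⟩
    obtain ⟨γ, h4, h5⟩ := h2 j
    exact h5.mono (Order.lt_succ_iff.1 h4)
  choose g hg hgf using hnode'
  have hmem : ∀ z : P.Y M, ∀ n, c z = n ↔ ∃ k, ∀ j, z.1 ∈ (g n k j).interp := by
    intro z n
    have e : c z = n ↔ z ∈ c ⁻¹' {n} := Iff.rfl
    rw [e, hdc n z, ← hfd n]
    simp only [BorelColouring.BorelCode.interp, ← hgf, Set.compl_iUnion, compl_compl,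
      Set.mem_iUnion, Set.mem_iInter]
  refine BorelColouring.Presentation.not_exists_cover hs h1 hM (ι := ℕ × ℕ)
    (O := fun i => g i.1 i.2) (fun i j => hg _ _ j) ?_ ?_
  · rintro ⟨n, k⟩ z z' hzz ⟨h2, h3⟩
    exact hadj z z' hzz (((hmem z n).2 ⟨k, h2⟩).trans ((hmem z' n).2 ⟨k, h3⟩).symm)
  · intro z hz
    obtain ⟨k, hk⟩ := (hmem ⟨z, hz⟩ _).1 rfl
    exact ⟨(_, k), hk⟩
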